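/- Let $F \in \mathbb{Q}[x,y]$ be a polynomial such that for all but finitely many $c \in \overline{\mathbb{Q}}$ the affine plane curve $F(x,y) = c$ is isomorphic over $\overline{\mathbb{Q}}$ to $\mathbb{A}^1_* = \mathbb{A}^1 \setminus \{0\}$ (that is, $\overline{\mathbb{Q}}[x,y]/(F-c) \cong \overline{\mathbb{Q}}[t,t^{-1}]$). Let $C$ be the affine plane curve $F(x,y)=0$ over $\mathbb{R}$ (the scheme $\operatorname{Spec} \mathbb{R}[x,y]/(F)$), and suppose that $C$ is isomorphic over $\mathbb{R}$ to $\mathbb{P}^1$ minus two distinct real points; choose the coordinate $t$ on $\mathbb{P}^1$ so that these points are $0$ and $\infty$, and let $\phi = (f,g) : \mathbb{A}^1_* \to C \subset \mathbb{A}^2$, with $f, g \in \mathbb{R}[t,t^{-1}]$, be such an isomorphism. Let $\tilde\phi : \mathbb{P}^1 \to \mathbb{P}^2$ be the extension of $\phi$, where $\mathbb{A}^2 \subset \mathbb{P}^2$ via $(x,y) \mapsto (x:y:1)$, and assume that $\tilde\phi(0) \neq \tilde\phi(\infty)$. Then the set $R = \{(x,y) \in \mathbb{Q}^2 \mid F(x,y)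 < 0\}$ satisfies weak approximation in the following sense: for every $(x_0,y_0) \in \mathbb{Q}^2$ and every integer $N \ge 1$ there exists $(x,y) \in R$ such that $x - x_0 \in N\mathbb{Z}$ and $y - y_0 \in N\mathbb{Z}$. -/

import Mathlib

open scoped LaurentPolynomial LinearAlgebra.Projectivization

noncomputable section

namespace PlaneCurve

/-- The coordinate ring `K[x, y] / (G)` of the affine plane curve `G = 0`. -/
abbrev CoordRing {K : Type} [Field K] (G : MvPolynomial (Fin 2) K) : Type :=
  MvPolynomial (Fin 2) K ⧸ Ideal.span {G}

/-- An isomorphism over `K` between the punctured affine line `𝔸¹ \ {0} = Spec K[t, t⁻¹]`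
(that is, `ℙ¹` minus the two `K`-points `0` and `∞`) and the affine plane curve `G = 0`,
as affine schemes, given by the isomorphism of coordinate rings. -/
abbrev Parametrisation {K : Type} [Field K] (G : MvPolynomial (Fin 2) K) : Type :=
  CoordRing G ≃ₐ[K] K[T;T⁻¹]

/-- The curve `G = 0` is isomorphic over `K` to the punctured affine line. -/
def IsPuncturedLine {K : Type} [Field K] (G : MvPolynomial (Fin 2) K) : Prop :=
  Nonempty (Parametrisation G)

/-- The components `(f, g)` of the morphism `t ↦ (f t, g t)` from the punctured line to the plane. -/
def Parametrisation.component {K : Type} [Field K] {G : MvPolynomial (Fin 2) K}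
    (φ : Parametrisation G) (i : Fin 2) : K[T;T⁻¹] :=
  φ (Ideal.Quotient.mk (Ideal.span {G}) (MvPolynomial.X i))

/-- The larger of the orders of the poles of `f` and `g` at `t = 0` (zero if there is no pole). -/
def poleOrder {K : Type} [Field K] (f g : K[T;T⁻¹]) : ℕ :=
  (f.coeff.support ∪ g.coeff.support).sup (fun n : ℤ => (-n).toNat)

/-- The value at `t = 0` of the polynomial vector `(t ^ m * f, t ^ m * g, t ^ m)`, where `m` is the
larger of the orders of the poles of `f` and `g` at `t = 0`. -/
def leadingVector {K : Type} [Field K] (f g : K[T;T⁻¹]) : Fin 3 → K :=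
  ![f.coeff (-(poleOrder f g : ℤ)), g.coeff (-(poleOrder f g : ℤ)),
    if poleOrder f g = 0 then 1 else 0]

theorem leadingVector_ne_zero {K : Type} [Field K] (f g : K[T;T⁻¹]) :
    leadingVector f g ≠ 0 := by
  intro h
  have h0 : f.coeff (-(poleOrder f g : ℤ)) = 0 := by simpa [leadingVector] using congrFun h 0
  have h1 : g.coeff (-(poleOrder f g : ℤ)) = 0 := by simpa [leadingVector] using congrFun h 1
  have h2 : poleOrder f g ≠ 0 := by simpa [leadingVector] using congrFun h 2
  have hne : (f.coeff.support ∪ g.coeff.support).Nonempty := by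
    by_contra hc
    rw [Finset.not_nonempty_iff_eq_empty] at hc
    exact h2 (by simp [poleOrder, hc])
  obtain ⟨n, hn, hm⟩ := Finset.exists_mem_eq_sup _ hne (fun n : ℤ => (-n).toNat)
  have hm' : poleOrder f g = (-n).toNat := hm
  have hn' : -(poleOrder f g : ℤ) = n := by omega
  rw [hn'] at h0 h1
  simp [h0, h1] at hn

/-- The image of `t = 0` under the extension `ℙ¹ → ℙ²` of the map
`t ↦ (f t, g t) = (f t : g t : 1)`; the affine plane is the chart `(x, y) ↦ (x : y : 1)`. -/
def valueAtZero {K : Type} [Field K] (f g : K[T;T⁻¹]) : ℙ K (Fin 3 → K) :=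
  Projectivization.mk K (leadingVector f g) (leadingVector_ne_zero f g)

/-- The image in `ℙ²` of the deleted point `0` under the extension of `φ` to `ℙ¹`. -/
def Parametrisation.imageZero {K : Type} [Field K] {G : MvPolynomial (Fin 2) K}
    (φ : Parametrisation G) : ℙ K (Fin 3 → K) :=
  valueAtZero (Parametrisation.component φ 0) (Parametrisation.component φ 1)

/-- The image in `ℙ²` of the deleted point `∞` under the extension of `φ` to `ℙ¹`, computed in the
coordinate `t⁻¹` around `∞`. -/
def Parametrisation.imageInfty {K : Type} [Field K] {G : MvPolynomial (Fin 2) K}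
    (φ : Parametrisation G) : ℙ K (Fin 3 → K) :=
  valueAtZero (LaurentPolynomial.invert (Parametrisation.component φ 0))
    (LaurentPolynomial.invert (Parametrisation.component φ 1))

/-- Weak approximation for a set `R` of rational points of the plane: `R` meets every coset of
`(N ℤ)²` in `ℚ²`, for every positive integer `N`. -/
def WeakApproximation (R : Set (ℚ × ℚ)) : Prop :=
  ∀ (x₀ y₀ : ℚ) (N : ℕ), 0 < N →
    ∃ p ∈ R, (∃ k : ℤ, p.1 - x₀ = N * k) ∧ (∃ l : ℤ, p.2 - y₀ = N * l)

end PlaneCurve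

end

noncomputable section

namespace PlaneCurve

/-! Write F = ∑ Hᵢ with Hᵢ homogeneous of degree i and d = deg F. If H_d(p, q) < 0 for some rational
(p, q), then F is negative far out on every ray of direction (p, q); scaling the direction into
(Nℤ)² keeps the congruences, and weak approximation follows (`weakApproximation_of_neg`). So it
suffices to exclude that H_d ≥ 0 on ℚ², hence on ℝ².

The two distinct real points at infinity of F = 0 are zeros of H_d; take them as coordinate
directions. All curves F = c share H_d, so over ℂ infinitely many punctured lines in the pencil have
one place at each of these two points. Counting intersections with lines and conjugate branches
gives H_d = κ xᵃ yᵇ, where b and a are the pole orders at (1:0:0) and (0:1:0) and a + b = d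
(`IsParam.add_eq_degree`, `HorizontalPole.le_of_dehomog_eq`). Nonnegativity would make a and b even,
which `leading_form_not_square` excludes.

For that, smoothness gives F_y(f, g) = l tᵉ · t f' and F_x(f, g) = -l tᵉ · t g'
(`IsParam.exists_pderiv_eq`). Near (1:0:0), with z = uᵇ, the curve is a power series y_c(u) solving
Φ(Y) = c u^(bd), and Φ'(y_c) has order at least e + b(d - 2). On the other hand, some member of the
infinite family has Φ'(y_c) of order bd - r, where r is the order of contact within an infinite
subfamily. Always r ≥ d. If b and d are even, r = d is impossible, because y_c(-u) solves the same
equation and differs from y_c in an odd order (`exists_order_derivative_lt`, `false_of_conjugate`).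
Hence e < 2b - d. At the other point t ↦ 1/t turns e into -e, so -e < 2a - d. Both hold for a common
c, and adding them gives 0 < 2(a + b - d) = 0. -/

/-! ### Contact of power series solutions in a one-parameter family. -/

theorem constantCoeff_eval {k : Type*} [CommRing k] (P : Polynomial (PowerSeries k))
    (w : PowerSeries k) : PowerSeries.constantCoeff (P.eval w) =
      (P.map PowerSeries.constantCoeff).eval (PowerSeries.constantCoeff w) := by
  rw [Polynomial.eval_map_apply]

theorem rescale_C {k : Type*} [CommRing k] (a c : k) :
    PowerSeries.rescale a (PowerSeries.C c) = PowerSeries.C c := by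
  ext n
  rw [PowerSeries.coeff_rescale, PowerSeries.coeff_C]
  split_ifs with h <;> simp [h]

/-- Pigeonhole principle for an infinite family of power series that are separated by finitely
many coefficients. -/
theorem exists_common_truncation {k : Type*} [Field k] (S : Set k) (hS : S.Infinite)
    (y : k → PowerSeries k) (D : ℕ)
    (hD : ∀ c ∈ S, ∀ c' ∈ S, PowerSeries.X ^ D ∣ y c - y c' → c = c') :
    ∃ r, ∃ S' ⊆ S, ∃ c₀ ∈ S', (∀ c ∈ S', PowerSeries.X ^ r ∣ y c - y c₀) ∧
      ((fun c => PowerSeries.coeff r (y c - y c₀)) '' S').Infinite := by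
  classical
  let P : ℕ → Prop := fun r => ∃ S' ⊆ S, S'.Infinite ∧ ∃ c₀ ∈ S', ∀ c ∈ S',
    PowerSeries.X ^ r ∣ y c - y c₀
  have hP0 : P 0 := by
    obtain ⟨c₀, hc₀⟩ := hS.nonempty
    exact ⟨S, subset_rfl, hS, c₀, hc₀, fun c _ => by simp⟩
  have hPD : ¬ P D := by
    rintro ⟨S', hS', hinf, c₀, hc₀, h⟩
    apply hinf
    apply (Set.finite_singleton c₀).subset
    intro c hc
    exact hD c (hS' hc) c₀ (hS' hc₀) (h c hc)
  have hex : ∃ r, ¬ P r := ⟨D, hPD⟩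
  obtain ⟨r, hr⟩ : ∃ r, Nat.find hex = r + 1 := by
    refine Nat.exists_eq_succ_of_ne_zero fun h => ?_
    exact (h ▸ Nat.find_spec hex) hP0
  have h1 : P r := not_not.mp (Nat.find_min hex (by omega))
  have h2 : ¬ P (r + 1) := hr ▸ Nat.find_spec hex
  obtain ⟨S', hS', hinf, c₀, hc₀, h⟩ := h1
  refine ⟨r, S', hS', c₀, hc₀, h, fun hfin => hinf ?_⟩
  -- By maximality of `r` no infinite subfamily agrees to order `r + 1`, so every value of the
  -- coefficient of index `r` is taken finitely often.
  refine Set.Finite.of_finite_fibers (fun c => PowerSeries.coeff r (y c - y c₀)) hfin ?_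
  intro x _
  by_contra hx
  obtain ⟨c₁, hc₁⟩ := Set.Infinite.nonempty hx
  refine h2 ⟨_, Set.inter_subset_left.trans hS', hx, c₁, hc₁, ?_⟩
  intro c hc
  rw [PowerSeries.X_pow_dvd_iff]
  intro m hm
  have e : y c - y c₁ = (y c - y c₀) - (y c₁ - y c₀) := by ring
  rw [e, map_sub]
  rcases Nat.lt_succ_iff_lt_or_eq.mp hm with hm | rfl
  · rw [PowerSeries.X_pow_dvd_iff.mp (h c hc.1) m hm,
      PowerSeries.X_pow_dvd_iff.mp (h c₁ hc₁.1) m hm, sub_zero]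
  · have a1 : PowerSeries.coeff m (y c - y c₀) = x := hc.2
    have a2 : PowerSeries.coeff m (y c₁ - y c₀) = x := hc₁.2
    rw [a1, a2, sub_self]

theorem C_X_dvd_of_map_eq_zero {k : Type*} [Field k] (P : Polynomial (PowerSeries k))
    (h : P.map PowerSeries.constantCoeff = 0) :
    Polynomial.C PowerSeries.X ∣ P := by
  rw [Polynomial.C_dvd_iff_dvd_coeff]
  intro i
  rw [PowerSeries.X_dvd_iff]
  simpa using congrArg (fun q => q.coeff i) h

/-- While the right-hand side is divisible by `X`, the reduction of `Ψ` modulo `X` has infinitely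
many roots, the residues of the `w c`. So it vanishes, a factor `X` splits off, and the argument
repeats. -/
theorem C_X_pow_dvd_of_eval {k : Type*} [Field k] (Ψ : Polynomial (PowerSeries k)) (D : ℕ)
    (S : Set k) (w : k → PowerSeries k)
    (hinf : ((fun c => PowerSeries.constantCoeff (w c)) '' S).Infinite)
    (hw : ∀ c ∈ S, Ψ.eval (w c) = PowerSeries.C c * PowerSeries.X ^ D) :
    ∀ m ≤ D, Polynomial.C (PowerSeries.X ^ m) ∣ Ψ := by
  intro m
  induction m with
  | zero => intro _; simp
  | succ m ih =>
    intro hm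
    obtain ⟨Ψ₁, h₁⟩ := ih (by omega)
    have hz : Ψ₁.map PowerSeries.constantCoeff = 0 := by
      refine Polynomial.eq_zero_of_infinite_isRoot _ (hinf.mono ?_)
      rintro _ ⟨c, hc, rfl⟩
      have h2 := hw c hc
      rw [h₁, Polynomial.eval_mul, Polynomial.eval_C] at h2
      have h3 : Ψ₁.eval (w c) = PowerSeries.C c * PowerSeries.X ^ (D - m) := by
        apply PowerSeries.X_pow_mul_cancel (k := m)
        rw [h2, mul_left_comm, ← pow_add]
        congr 3
        omega
      rw [Set.mem_ofPred_eq, Polynomial.IsRoot.def]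
      rw [← constantCoeff_eval, h3]
      simp
      right
      omega
    obtain ⟨Ψ₂, h₂⟩ := C_X_dvd_of_map_eq_zero _ hz
    refine ⟨Ψ₂, ?_⟩
    rw [h₁, h₂, pow_succ, Polynomial.C_mul, mul_assoc]

theorem exists_eq_X_pow_mul {k : Type*} [Field k] (W : PowerSeries k) (hW : W ≠ 0) :
    ∃ w W', W = PowerSeries.X ^ w * W' ∧ PowerSeries.constantCoeff W' ≠ 0 := by
  classical
  have hex : ∃ n, PowerSeries.coeff n W ≠ 0 := by
    by_contra! h
    exact hW (PowerSeries.ext (by simpa using h))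
  obtain ⟨W', h⟩ : PowerSeries.X ^ (Nat.find hex) ∣ W := by
    rw [PowerSeries.X_pow_dvd_iff]
    intro m hm
    exact not_not.mp (Nat.find_min hex hm)
  refine ⟨_, W', h, ?_⟩
  have h1 := congrArg (PowerSeries.coeff (Nat.find hex)) h
  rw [PowerSeries.coeff_X_pow_mul', if_pos le_rfl, Nat.sub_self] at h1
  rw [← PowerSeries.coeff_zero_eq_constantCoeff_apply, ← h1]
  exact Nat.find_spec hex

theorem coeff_comp_C_add_C_mul_X {R : Type*} [CommRing R] (Φ : Polynomial R) (z a : R) (n : ℕ) :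
    (Φ.comp (Polynomial.C z + Polynomial.C a * Polynomial.X)).coeff n =
      (Polynomial.taylor z Φ).coeff n * a ^ n := by
  rw [← Polynomial.comp_C_mul_X_coeff, Polynomial.taylor_apply, Polynomial.comp_assoc]
  simp [add_comm]

/-- A centre that vanishes at `u = 0` does not change the residue polynomial, so for `κ ≠ 0` the
coefficient of index `b` stays a unit. This unit controls the orders of contact. -/
theorem constantCoeff_taylor_coeff {k : Type*} [Field k] (Φ : Polynomial (PowerSeries k)) (κ : k)
    (b : ℕ) (hmod : Φ.map PowerSeries.constantCoeff = Polynomial.C κ * Polynomial.X ^ b)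
    (z : PowerSeries k) (hz : PowerSeries.constantCoeff z = 0) :
    PowerSeries.constantCoeff ((Polynomial.taylor z Φ).coeff b) = κ := by
  rw [← Polynomial.coeff_map, Polynomial.map_taylor, hmod, hz]
  simp

/-- A power series solution whose conjugate under `u ↦ -u` is a different solution cannot lie
in a generic family of solutions with the least possible contact. -/
theorem false_of_conjugate {k : Type*} [Field k] (Φ : Polynomial (PowerSeries k))
    (κ : k) (hκ : κ ≠ 0) (b d : ℕ) (hb : 0 < b) (hd : Even d)
    (hmod : Φ.map PowerSeries.constantCoeff = Polynomial.C κ * Polynomial.X ^ b)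
    (y : PowerSeries k) (hy0 : PowerSeries.constantCoeff y = 0)
    (B : Polynomial (PowerSeries k))
    (hB : Φ.comp (Polynomial.C y + Polynomial.C (PowerSeries.X ^ d) * Polynomial.X) =
      Polynomial.C (PowerSeries.X ^ (b * d)) * B)
    (hB1 : PowerSeries.constantCoeff (B.coeff 1) ≠ 0)
    (hne : PowerSeries.rescale (-1) y ≠ y)
    (heq : Φ.eval (PowerSeries.rescale (-1) y) = Φ.eval y) : False := by
  obtain ⟨w, W, hW, hW0⟩ := exists_eq_X_pow_mul _ (sub_ne_zero.mpr hne)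
  -- Coefficients of even index cancel in y(-u) - y(u).
  have hwodd : Odd w := by
    by_contra hw
    rw [Nat.not_odd_iff_even] at hw
    have := congrArg (PowerSeries.coeff w) hW
    rw [map_sub, PowerSeries.coeff_rescale, hw.neg_one_pow, one_mul, sub_self,
      PowerSeries.coeff_X_pow_mul'] at this
    simp at this
    exact hW0 this.symm
  have hyW : PowerSeries.rescale (-1) y = y + PowerSeries.X ^ w * W := by rw [← hW]; ring
  rw [hyW] at heq
  have hwd : w ≠ d := by rintro rfl; exact (Nat.not_odd_iff_even.mpr hd) hwodd
  have hA : ∀ n, (Polynomial.taylor y Φ).coeff n * (PowerSeries.X ^ d) ^ n =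
      PowerSeries.X ^ (b * d) * B.coeff n := by
    intro n
    rw [← coeff_comp_C_add_C_mul_X, hB, Polynomial.coeff_C_mul]
  rcases lt_or_gt_of_ne hwd with hlt | hgt
  · set A := Polynomial.taylor y Φ with hAdef
    set Θ := Φ.comp (Polynomial.C y + Polynomial.C (PowerSeries.X ^ w) * Polynomial.X) with hΘ
    have hΘc : ∀ n, Θ.coeff n = A.coeff n * (PowerSeries.X ^ w) ^ n :=
      coeff_comp_C_add_C_mul_X _ _ _
    have hw1 : 1 ≤ w := hwodd.pos
    -- For `w < d` only the term of degree `b` survives to order `w * b`: for `0 < n < b` the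
    -- coefficient has order at least d(b - n) + wn > wb, and for `n > b` already wn > wb.
    have hdvd : Polynomial.C (PowerSeries.X ^ (w * b + 1)) ∣
        Θ - Polynomial.C (A.coeff 0) -
          Polynomial.C (A.coeff b * PowerSeries.X ^ (w * b)) * Polynomial.X ^ b := by
      rw [Polynomial.C_dvd_iff_dvd_coeff]
      intro n
      rw [Polynomial.coeff_sub, Polynomial.coeff_sub, hΘc, Polynomial.coeff_C,
        Polynomial.coeff_C_mul_X_pow]
      rcases Nat.eq_zero_or_pos n with rfl | hn
      · rw [if_pos rfl, if_neg (by omega)]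
        simp
      rw [if_neg (by omega)]
      rcases lt_trichotomy n b with h | h | h
      · rw [if_neg (by omega)]
        have h1 : A.coeff n = PowerSeries.X ^ (d * (b - n)) * B.coeff n := by
          apply PowerSeries.X_pow_mul_cancel (k := d * n)
          rw [mul_comm, pow_mul, hA, ← mul_assoc, ← pow_mul, ← pow_add, ← mul_add,
            Nat.add_sub_cancel' h.le, mul_comm b d]
        rw [h1, sub_zero, sub_zero, mul_right_comm, ← pow_mul, ← pow_add]
        apply Dvd.dvd.mul_right
        apply pow_dvd_pow
        obtain ⟨j, rfl⟩ := Nat.exists_eq_add_of_lt h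
        have : n + j + 1 - n = j + 1 := by omega
        rw [this]
        nlinarith
      · subst h
        rw [if_pos rfl, ← pow_mul]
        simp
      · rw [if_neg (by omega), sub_zero, sub_zero, ← pow_mul]
        apply Dvd.dvd.mul_left
        apply pow_dvd_pow
        nlinarith
    obtain ⟨E, hE⟩ := hdvd
    have h2 := congrArg (Polynomial.eval W) hE
    -- Both conjugates give `Φ` the same value, so the surviving term, with leading coefficient κ
    -- W(0)ᵇ, has to vanish.
    have h3 : Θ.eval W = A.coeff 0 := by
      rw [hΘ, Polynomial.eval_comp, hAdef, Polynomial.taylor_coeff_zero]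
      simpa using heq
    simp only [Polynomial.eval_sub, h3, Polynomial.eval_mul, Polynomial.eval_C,
      Polynomial.eval_pow, Polynomial.eval_X, sub_self, zero_sub] at h2
    have h4 := congrArg (PowerSeries.coeff (w * b)) h2
    rw [mul_right_comm, map_neg, PowerSeries.coeff_mul_X_pow', PowerSeries.coeff_X_pow_mul'] at h4
    have h5 : PowerSeries.constantCoeff (A.coeff b) = κ :=
      constantCoeff_taylor_coeff Φ κ b hmod y hy0
    simp [h5] at h4
    rcases h4 with h4 | h4
    · exact hκ h4
    · exact hW0 h4.1
  · obtain ⟨j, rfl⟩ := Nat.exists_eq_add_of_lt hgt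
    -- Here `w = d + j + 1`, so the conjugate gives a nonzero root of `B - B(0)` with residue 0.
    -- This is impossible, since 0 is a simple root of its residue polynomial.
    have h1 : B.eval (PowerSeries.X ^ (j + 1) * W) = B.coeff 0 := by
      apply PowerSeries.X_pow_mul_cancel (k := b * d)
      have h2 := congrArg (Polynomial.eval (PowerSeries.X ^ (j + 1) * W)) hB
      have h3 := hA 0
      rw [Polynomial.taylor_coeff_zero] at h3
      rw [Polynomial.eval_mul, Polynomial.eval_C] at h2
      rw [← h2, ← h3, pow_zero, mul_one, ← heq, Polynomial.eval_comp]
      simp only [Polynomial.eval_add, Polynomial.eval_C, Polynomial.eval_mul, Polynomial.eval_X]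
      congr 2
      ring
    have h2 := congrArg (Polynomial.eval (PowerSeries.X ^ (j + 1) * W))
      (Polynomial.divX_mul_X_add B)
    rw [h1] at h2
    simp only [Polynomial.eval_add, Polynomial.eval_C, Polynomial.eval_mul, Polynomial.eval_X,
      add_eq_right] at h2
    have hWne : PowerSeries.X ^ (j + 1) * W ≠ 0 := by
      refine mul_ne_zero (pow_ne_zero _ PowerSeries.X_ne_zero) ?_
      rintro rfl
      simp at hW0
    have h3 := (mul_eq_zero.mp h2).resolve_right hWne
    have h4 := congrArg PowerSeries.constantCoeff h3
    rw [constantCoeff_eval] at h4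
    have h5 : PowerSeries.constantCoeff (PowerSeries.X ^ (j + 1) * W : PowerSeries k) = 0 := by
      simp
    rw [h5, ← Polynomial.coeff_zero_eq_eval_zero, Polynomial.coeff_map, Polynomial.coeff_divX] at h4
    exact hB1 (by simpa using h4)

/-- In an infinite family of solutions of `Φ(y) = c u ^ (b d)` without the symmetry `u ↦ -u`,
the order of `Φ'(y)` is less than `d (b - 1)` for some member. -/
theorem exists_order_derivative_lt {k : Type*} [Field k] [CharZero k]
    (Φ : Polynomial (PowerSeries k))
    (κ : k) (hκ : κ ≠ 0) (b d : ℕ) (hb : 0 < b) (hd : Even d)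
    (hmod : Φ.map PowerSeries.constantCoeff = Polynomial.C κ * Polynomial.X ^ b)
    (hsymm : Φ.map (PowerSeries.rescale (-1)) = Φ)
    (S : Set k) (hS : S.Infinite) (y : k → PowerSeries k)
    (hy0 : ∀ c ∈ S, PowerSeries.constantCoeff (y c) = 0)
    (hy : ∀ c ∈ S, Φ.eval (y c) = PowerSeries.C c * PowerSeries.X ^ (b * d))
    (hne : ∀ c ∈ S, PowerSeries.rescale (-1) (y c) ≠ y c) :
    ∃ c ∈ S, ∃ i < d * (b - 1),
      PowerSeries.coeff i (Φ.derivative.eval (y c)) ≠ 0 := by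
  -- Agreement to order `b * d + 1` forces equal coefficients of index `b * d` in `Φ(y c)` and `Φ(y
  -- c')`, and these are `c` and `c'`.
  obtain ⟨r, S', hS', c₀, hc₀, hr, hinf⟩ := exists_common_truncation S hS y (b * d + 1) (by
    intro c hc c' hc' h
    have h1 := h.trans (Polynomial.sub_dvd_eval_sub (y c) (y c') Φ)
    rw [hy c hc, hy c' hc', PowerSeries.X_pow_dvd_iff] at h1
    have h2 := h1 (b * d) (by omega)
    rw [← sub_mul, PowerSeries.coeff_mul_X_pow'] at h2
    simpa [sub_eq_zero] using h2)
  choose! w hw using hr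
  have hyw : ∀ c ∈ S', y c = y c₀ + PowerSeries.X ^ r * w c := fun c hc => by
    rw [← hw c hc]; ring
  have himg : (fun c => PowerSeries.coeff r (y c - y c₀)) '' S' =
      (fun c => PowerSeries.constantCoeff (w c)) '' S' := by
    refine Set.image_congr fun c hc => ?_
    rw [hw c hc, PowerSeries.coeff_X_pow_mul']
    simp
  rw [himg] at hinf
  set Ψ := Φ.comp (Polynomial.C (y c₀) + Polynomial.C (PowerSeries.X ^ r) * Polynomial.X) with hΨ
  have hΨw : ∀ c ∈ S', Ψ.eval (w c) = PowerSeries.C c * PowerSeries.X ^ (b * d) := by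
    intro c hc
    rw [← hy c (hS' hc), hyw c hc, hΨ, Polynomial.eval_comp]
    simp
  obtain ⟨Ψ₂, h₂⟩ := C_X_pow_dvd_of_eval Ψ (b * d) S' w hinf hΨw (b * d) le_rfl
  have hΨ₂ : ∀ c ∈ S', Ψ₂.eval (w c) = PowerSeries.C c := by
    intro c hc
    have h3 := hΨw c hc
    rw [h₂, Polynomial.eval_mul, Polynomial.eval_C, mul_comm] at h3
    exact PowerSeries.mul_X_pow_cancel h3
  set G := Ψ₂.map PowerSeries.constantCoeff with hG
  have hGc : ∀ c ∈ S', G.eval (PowerSeries.constantCoeff (w c)) = c := by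
    intro c hc
    rw [hG, ← constantCoeff_eval, hΨ₂ c hc]
    simp
  have hG' : G.derivative ≠ 0 := by
    intro h0
    have h1 := Polynomial.eq_C_of_derivative_eq_zero h0
    have hsub : S' ⊆ {G.coeff 0} := by
      intro c hc
      have := hGc c hc
      rw [h1, Polynomial.eval_C] at this
      exact this.symm
    exact hinf (((Set.finite_singleton _).subset hsub).image _)
  obtain ⟨c, hc, hroot⟩ : ∃ c ∈ S', G.derivative.eval (PowerSeries.constantCoeff (w c)) ≠ 0 := by
    by_contra! h
    refine hG' (Polynomial.eq_zero_of_infinite_isRoot _ (hinf.mono ?_))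
    rintro _ ⟨c, hc, rfl⟩
    exact h c hc
  -- The coefficient of degree `b` of `Ψ` has order exactly `r * b`, and `Ψ` is divisible by u^(bd).
  have hrd : d ≤ r := by
    have h3 : (Polynomial.taylor (y c₀) Φ).coeff b * (PowerSeries.X ^ r) ^ b =
        PowerSeries.X ^ (b * d) * Ψ₂.coeff b := by
      rw [← coeff_comp_C_add_C_mul_X, ← hΨ, h₂, Polynomial.coeff_C_mul]
    by_contra hlt
    have hlt' : r * b < b * d := by nlinarith
    have h4 := congrArg (PowerSeries.coeff (r * b)) h3
    rw [← pow_mul, PowerSeries.coeff_mul_X_pow', PowerSeries.coeff_X_pow_mul',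
      if_pos le_rfl, if_neg (by omega), Nat.sub_self] at h4
    have h5 := constantCoeff_taylor_coeff Φ κ b hmod _ (hy0 c₀ (hS' hc₀))
    simp [h5, hκ] at h4
  -- Chain rule. As Ψ₂'(w c) is a unit, Φ'(y c) has order exactly bd - r.
  have hder : PowerSeries.X ^ r * Φ.derivative.eval (y c) =
      PowerSeries.X ^ (b * d) * Ψ₂.derivative.eval (w c) := by
    have h3 := congrArg (fun p => (Polynomial.derivative p).eval (w c)) h₂
    simp only [hΨ, Polynomial.derivative_comp, Polynomial.derivative_mul, Polynomial.derivative_C,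
      zero_mul, zero_add, Polynomial.eval_mul, Polynomial.eval_comp, Polynomial.derivative_add,
      Polynomial.derivative_X, mul_one, Polynomial.eval_C, Polynomial.eval_add,
      Polynomial.eval_X] at h3
    rw [hyw c hc, ← h3]
  have hcoef : PowerSeries.coeff 0 (Ψ₂.derivative.eval (w c)) ≠ 0 := by
    rw [PowerSeries.coeff_zero_eq_constantCoeff, constantCoeff_eval, ← Polynomial.derivative_map]
    exact hroot
  have hrD : r ≤ b * d := by
    by_contra hlt
    have h4 := congrArg (PowerSeries.coeff (b * d)) hder
    rw [PowerSeries.coeff_X_pow_mul', if_neg hlt, PowerSeries.coeff_X_pow_mul', if_pos le_rfl,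
      Nat.sub_self] at h4
    exact hcoef h4.symm
  rcases hrd.lt_or_eq with hlt | heq
  · refine ⟨c, hS' hc, b * d - r, ?_, ?_⟩
    · rw [Nat.mul_sub, mul_one, mul_comm d b]
      omega
    · have h4 := congrArg (PowerSeries.coeff (b * d)) hder
      rw [PowerSeries.coeff_X_pow_mul', if_pos hrD, PowerSeries.coeff_X_pow_mul', if_pos le_rfl,
        Nat.sub_self] at h4
      rw [h4]
      exact hcoef
  -- The borderline case r = d. Recentring at `y c` makes the degree-one coefficient a unit, as the
  -- conjugation argument requires.
  · exfalso
    subst heq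
    refine false_of_conjugate Φ κ hκ b d hb hd hmod (y c) (hy0 c (hS' hc))
      (Polynomial.taylor (w c) Ψ₂) ?_ ?_ (hne c (hS' hc)) ?_
    · have h3 := congrArg (Polynomial.taylor (w c)) h₂
      rw [Polynomial.taylor_mul, Polynomial.taylor_C] at h3
      rw [← h3, hΨ, Polynomial.taylor_apply, Polynomial.comp_assoc, hyw c hc]
      congr 1
      simp
      ring
    · rw [Polynomial.taylor_coeff_one]
      simpa using hcoef
    · conv_lhs => rw [← hsymm]
      rw [Polynomial.eval_map_apply, hy c (hS' hc), map_mul, map_pow, PowerSeries.rescale_X,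
        rescale_C, mul_pow, ← map_pow, (hd.mul_left b).neg_one_pow]
      simp

/-! ### Evaluation of polynomials in two variables and dehomogenisation. -/

section Pair

variable {k : Type*} [Field k]

open MvPolynomial in
theorem map_aeval_pair {A B : Type*} [CommRing A] [CommRing B] [Algebra k A] [Algebra k B]
    (φ : A →ₐ[k] B) (p q : A) (P : MvPolynomial (Fin 2) k) :
    φ (aeval ![p, q] P) = aeval ![φ p, φ q] P := by
  rw [← AlgHom.comp_apply, comp_aeval]
  congr 2
  funext i
  fin_cases i <;> rfl

open MvPolynomial in
theorem aeval_pair_ext {A : Type*} [CommRing A] [Algebra k A] (φ : MvPolynomial (Fin 2) k →ₐ[k] A)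
    (P : MvPolynomial (Fin 2) k) : φ P = aeval ![φ (X 0), φ (X 1)] P := by
  conv_lhs => rw [← aeval_X_left_apply P]
  have : (X : Fin 2 → MvPolynomial (Fin 2) k) = ![X 0, X 1] := by
    funext i
    fin_cases i <;> rfl
  rw [this, map_aeval_pair]
  rfl

open MvPolynomial in
theorem aeval_mul_of_isHomogeneous {A : Type*} [CommRing A] [Algebra k A]
    {P : MvPolynomial (Fin 2) k} {i : ℕ} (hP : P.IsHomogeneous i) (c p q : A) :
    aeval ![c * p, c * q] P = c ^ i * aeval ![p, q] P := by
  rw [aeval_def, aeval_def, eval₂_eq', eval₂_eq', Finset.mul_sum]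
  refine Finset.sum_congr rfl fun s hs => ?_
  have h1 : s 0 + s 1 = i := by
    have := hP (mem_support_iff.mp hs)
    simpa [Finsupp.weight_apply, Finsupp.sum_fintype] using this
  simp only [Fin.prod_univ_two, Matrix.cons_val_zero, Matrix.cons_val_one]
  rw [← h1]
  ring

open MvPolynomial in
/-- The chain rule for a polynomial in two variables. -/
theorem derivation_aeval_pair {A M : Type*} [CommRing A] [Algebra k A] [AddCommGroup M]
    [Module A M] [Module k M]
    (D : Derivation k A M) (p q : A) (P : MvPolynomial (Fin 2) k) :
    D (aeval ![p, q] P) =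
      aeval ![p, q] (pderiv 0 P) • D p + aeval ![p, q] (pderiv 1 P) • D q := by
  induction P using MvPolynomial.induction_on with
  | C a => simp
  | add P Q hP hQ =>
    simp only [map_add, hP, hQ, add_smul]
    abel
  | mul_X P i hP =>
    rw [map_mul, D.leibniz, hP]
    fin_cases i
    · simp [pderiv_X, add_smul, mul_smul, smul_add]
      simp only [← mul_smul]
      abel
    · simp [pderiv_X, add_smul, mul_smul, smul_add]
      simp only [← mul_smul]
      abel

/-- The dehomogenization `P(1, Y)`. -/
def dehomog (P : MvPolynomial (Fin 2) k) : Polynomial k :=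
  MvPolynomial.aeval ![1, Polynomial.X] P

theorem aeval_dehomog {A : Type*} [CommRing A] [Algebra k A] (P : MvPolynomial (Fin 2) k) (q : A) :
    Polynomial.aeval q (dehomog P) = MvPolynomial.aeval ![1, q] P := by
  rw [dehomog, map_aeval_pair]
  simp

theorem derivative_dehomog (P : MvPolynomial (Fin 2) k) :
    Polynomial.derivative (dehomog P) = dehomog (MvPolynomial.pderiv 1 P) := by
  have := derivation_aeval_pair (Polynomial.derivative' (R := k)) 1 Polynomial.X P
  simpa [dehomog] using this

theorem aeval_pair_eq_dehomog {A : Type*} [CommRing A] [Algebra k A]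
    {P : MvPolynomial (Fin 2) k} {i : ℕ} (hP : P.IsHomogeneous i) (p q : A) :
    MvPolynomial.aeval ![p, p * q] P = p ^ i * Polynomial.aeval q (dehomog P) := by
  have := aeval_mul_of_isHomogeneous hP p 1 q
  rw [mul_one] at this
  rw [this, aeval_dehomog]

end Pair

/-! ### The Euler derivation on Laurent polynomials. -/

section LaurentDerivation

variable {k : Type*} [Field k]

/-- The derivation `T d/dT` of the ring of Laurent polynomials, as a linear map. -/
def eulerLinear : k[T;T⁻¹] →ₗ[k] k[T;T⁻¹] where
  toFun p := .ofCoeff (p.coeff.sum fun n a => Finsupp.single n (n * a))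
  map_add' p q := by
    rw [AddMonoidAlgebra.coeff_add, Finsupp.sum_add_index']
    · rfl
    · simp
    · intro n a b
      rw [mul_add, Finsupp.single_add]
  map_smul' c p := by
    ext n
    rw [AddMonoidAlgebra.coeff_smul, Finsupp.sum_smul_index (by simp)]
    simp [Finsupp.sum, Finsupp.single_apply]
    split_ifs <;> ring

theorem coeff_eulerLinear (p : k[T;T⁻¹]) (n : ℤ) :
    (eulerLinear p).coeff n = n * p.coeff n := by
  simp [eulerLinear, Finsupp.sum, Finsupp.single_apply]
  tauto

theorem coeff_C_mul_T (a : k) (n m : ℤ) :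
    (LaurentPolynomial.C a * LaurentPolynomial.T n).coeff m = if n = m then a else 0 := by
  rw [← LaurentPolynomial.single_eq_C_mul_T, AddMonoidAlgebra.coeff_single, Finsupp.single_apply]

theorem eulerLinear_C_mul_T (a : k) (n : ℤ) :
    eulerLinear (LaurentPolynomial.C a * LaurentPolynomial.T n) =
      LaurentPolynomial.C (n * a) * LaurentPolynomial.T n := by
  ext m
  rw [coeff_eulerLinear, coeff_C_mul_T, coeff_C_mul_T]
  split_ifs with h <;> simp [h]

/-- The derivation `T d/dT` of the ring of Laurent polynomials. -/
def euler : Derivation k k[T;T⁻¹] k[T;T⁻¹] :=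
  Derivation.mk' eulerLinear (by
    intro p q
    induction p using LaurentPolynomial.induction_on' with
    | add p p' hp hp' =>
      rw [add_mul, map_add, hp, hp', map_add, smul_add, add_smul]
      abel
    | C_mul_T n a =>
      induction q using LaurentPolynomial.induction_on' with
      | add q q' hq hq' =>
        rw [mul_add, map_add, hq, hq', map_add, smul_add, add_smul]
        abel
      | C_mul_T m b =>
        have : LaurentPolynomial.C a * LaurentPolynomial.T n *
            (LaurentPolynomial.C b * LaurentPolynomial.T m) =
            LaurentPolynomial.C (a * b) * LaurentPolynomial.T (n + m) := by
          rw [map_mul, LaurentPolynomial.T_add]; ring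
        rw [this, eulerLinear_C_mul_T, eulerLinear_C_mul_T, eulerLinear_C_mul_T, smul_eq_mul,
          smul_eq_mul, LaurentPolynomial.T_add]
        simp only [map_mul, map_add, Int.cast_add]
        ring)

theorem coeff_euler (p : k[T;T⁻¹]) (n : ℤ) : (euler p).coeff n = n * p.coeff n :=
  coeff_eulerLinear p n

theorem euler_T (n : ℤ) : euler (LaurentPolynomial.T n : k[T;T⁻¹]) =
    LaurentPolynomial.C (n : k) * LaurentPolynomial.T n := by
  have := eulerLinear_C_mul_T (1 : k) n
  rw [map_one, one_mul, mul_one] at this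
  exact this

theorem euler_toLaurent (q : Polynomial k) : euler (Polynomial.toLaurent q) =
    Polynomial.toLaurent (Polynomial.X * Polynomial.derivative q) := by
  induction q using Polynomial.induction_on' with
  | add p q hp hq => rw [map_add, map_add, hp, hq, map_add, mul_add, map_add]
  | monomial n a =>
    rw [← Polynomial.C_mul_X_pow_eq_monomial, Polynomial.toLaurent_C_mul_X_pow,
      Polynomial.derivative_C_mul_X_pow]
    have h1 : euler (LaurentPolynomial.C a * LaurentPolynomial.T (n : ℤ)) = _ :=
      eulerLinear_C_mul_T a n
    rw [h1]
    rcases n with _ | n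
    · simp
    · rw [mul_left_comm, ← pow_succ', Nat.add_sub_cancel, Polynomial.toLaurent_C_mul_X_pow,
        mul_comm a]
      simp

theorem euler_invert (p : k[T;T⁻¹]) :
    euler (LaurentPolynomial.invert p) = -LaurentPolynomial.invert (euler p) := by
  ext n
  simp [coeff_euler]

end LaurentDerivation

/-! ### The equation of the pencil near the point (1:0:0). -/

section Chart

variable {k : Type*} [Field k]

/-- The equation `∑ Hᵢ = c` near the point `(1 : 0 : 0)` at infinity, pulled back along
`z = u ^ n`. -/
def chart (H : ℕ → MvPolynomial (Fin 2) k) (d n : ℕ) : Polynomial (PowerSeries k) :=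
  ∑ i ∈ Finset.range (d + 1),
    Polynomial.C (PowerSeries.X ^ (n * (d - i))) * (dehomog (H i)).map PowerSeries.C

theorem eval_chart (H : ℕ → MvPolynomial (Fin 2) k) (d n : ℕ) (y : PowerSeries k) :
    (chart H d n).eval y = ∑ i ∈ Finset.range (d + 1),
      PowerSeries.X ^ (n * (d - i)) * Polynomial.aeval y (dehomog (H i)) := by
  simp [chart, Polynomial.eval_finsetSum, Polynomial.eval_map, Polynomial.aeval_def]

theorem chart_map_constantCoeff (H : ℕ → MvPolynomial (Fin 2) k) (d n : ℕ) (hn : 0 < n) :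
    (chart H d n).map PowerSeries.constantCoeff = dehomog (H d) := by
  have hid : (PowerSeries.constantCoeff (R := k)).comp PowerSeries.C = RingHom.id k := by
    ext; simp
  rw [chart, Polynomial.map_sum, Finset.sum_range_succ, Finset.sum_eq_zero]
  · simp [Polynomial.map_map, hid]
  · intro i hi
    rw [Finset.mem_range] at hi
    have : n * (d - i) ≠ 0 := by
      have : 0 < d - i := by omega
      positivity
    simp [this]

/-- The variable u occurs only through uⁿ, so u ↦ ζu sends solutions of the chart equation to
solutions. -/
theorem chart_map_rescale (H : ℕ → MvPolynomial (Fin 2) k) (d n : ℕ) (ζ : k) (hζ : ζ ^ n = 1) :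
    (chart H d n).map (PowerSeries.rescale ζ) = chart H d n := by
  have hid : (PowerSeries.rescale ζ).comp PowerSeries.C = PowerSeries.C := by
    ext1 x; exact rescale_C ζ x
  rw [chart, Polynomial.map_sum]
  refine Finset.sum_congr rfl fun i _ => ?_
  rw [Polynomial.map_mul, Polynomial.map_map, hid, Polynomial.map_C, map_pow,
    PowerSeries.rescale_X, mul_pow, ← map_pow, pow_mul, hζ, one_pow, map_one, one_mul]

theorem derivative_chart (H : ℕ → MvPolynomial (Fin 2) k) (d n : ℕ)
    (hH : (H 0).IsHomogeneous 0) :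
    (chart H (d + 1) n).derivative = chart (fun i => MvPolynomial.pderiv 1 (H (i + 1))) d n := by
  rw [chart, chart, Finset.sum_range_succ', Polynomial.derivative_add, Polynomial.derivative_sum]
  have h0 : MvPolynomial.pderiv 1 (H 0) = 0 := by
    rw [← MvPolynomial.totalDegree_zero_iff_isHomogeneous,
      MvPolynomial.totalDegree_eq_zero_iff_eq_C] at hH
    rw [hH, MvPolynomial.pderiv_C]
  have h1 : Polynomial.derivative (dehomog (H 0)) = 0 := by
    rw [derivative_dehomog, h0, dehomog, map_zero]
  rw [Polynomial.derivative_C_mul, Polynomial.derivative_map, h1, Polynomial.map_zero, mul_zero,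
    add_zero]
  refine Finset.sum_congr rfl fun i _ => ?_
  rw [Polynomial.derivative_C_mul, Polynomial.derivative_map, derivative_dehomog,
    Nat.add_sub_add_right]

end Chart

/-! ### Extraction of an n-th root of the local coordinate at infinity. -/

section Root

variable {k : Type*} [Field k]

/-- Hensel's lemma for the equation `v ^ n = q (u v)`. -/
theorem exists_pow_eq_aeval_X_mul [IsAlgClosed k] [CharZero k] (q : Polynomial k) (n : ℕ)
    (hn : 0 < n) (hq : q.coeff 0 ≠ 0) :
    ∃ v : PowerSeries k, PowerSeries.constantCoeff v ≠ 0 ∧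
      v ^ n = Polynomial.aeval (PowerSeries.X * v) q := by
  -- The unknown is w = 1/v: multiplying vⁿ = q(uv) by w^M / q(0) gives a monic equation `p` for w,
  -- and `M` is large enough to clear all powers of v.
  set M := max q.natDegree n with hM
  set p : Polynomial (PowerSeries k) := Polynomial.X ^ M +
    (∑ j ∈ Finset.Icc 1 q.natDegree,
      Polynomial.C (PowerSeries.C ((q.coeff 0)⁻¹ * q.coeff j) * PowerSeries.X ^ j) *
        Polynomial.X ^ (M - j) -
      Polynomial.C (PowerSeries.C (q.coeff 0)⁻¹) * Polynomial.X ^ (M - n)) with hp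
  have hMn : n ≤ M := le_max_right _ _
  have hMq : q.natDegree ≤ M := le_max_left _ _
  have hmonic : p.Monic := by
    refine Polynomial.monic_X_pow_add ?_
    refine lt_of_le_of_lt (Polynomial.degree_sub_le _ _) (max_lt ?_ ?_)
    · refine lt_of_le_of_lt (Polynomial.degree_sum_le _ _) ?_
      rw [Finset.sup_lt_iff (by simp [bot_lt_iff_ne_bot])]
      intro j hj
      rw [Finset.mem_Icc] at hj
      refine lt_of_le_of_lt (Polynomial.degree_C_mul_X_pow_le _ _) ?_
      exact_mod_cast (by omega : M - j < M)
    · refine lt_of_le_of_lt (Polynomial.degree_C_mul_X_pow_le _ _) ?_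
      exact_mod_cast (by omega : M - n < M)
  obtain ⟨w₀, hw₀⟩ := IsAlgClosed.exists_pow_nat_eq (q.coeff 0)⁻¹ hn
  have hw₀0 : w₀ ≠ 0 := by
    rintro rfl
    rw [zero_pow hn.ne'] at hw₀
    exact inv_ne_zero hq hw₀.symm
  have hpmap : p.map PowerSeries.constantCoeff =
      Polynomial.X ^ M - Polynomial.C (q.coeff 0)⁻¹ * Polynomial.X ^ (M - n) := by
    rw [hp, Polynomial.map_add, Polynomial.map_sub, Polynomial.map_sum, Finset.sum_eq_zero]
    · simp; ring
    · intro j hj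
      rw [Finset.mem_Icc] at hj
      have : j ≠ 0 := by omega
      simp [this]
  have hroot : p.eval (PowerSeries.C w₀) ∈
      (Ideal.span {PowerSeries.X} : Ideal (PowerSeries k)) := by
    rw [Ideal.mem_span_singleton, PowerSeries.X_dvd_iff, constantCoeff_eval, hpmap]
    simp only [PowerSeries.constantCoeff_C, Polynomial.eval_sub, Polynomial.eval_pow,
      Polynomial.eval_X, Polynomial.eval_mul, Polynomial.eval_C]
    rw [← hw₀, ← pow_add, Nat.add_sub_cancel' hMn, sub_self]
  -- The derivative of the residue polynomial at `w₀` is n w₀^(M-1), which is nonzero in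
  -- characteristic 0.
  have hder : IsUnit (Ideal.Quotient.mk (Ideal.span {PowerSeries.X} : Ideal (PowerSeries k))
      (p.derivative.eval (PowerSeries.C w₀))) := by
    refine IsUnit.map _ ?_
    rw [PowerSeries.isUnit_iff_constantCoeff, constantCoeff_eval, ← Polynomial.derivative_map,
      hpmap, isUnit_iff_ne_zero]
    simp only [PowerSeries.constantCoeff_C, Polynomial.derivative_sub,
      Polynomial.derivative_X_pow, Polynomial.derivative_C_mul,
      Polynomial.eval_sub, Polynomial.eval_pow, Polynomial.eval_X, Polynomial.eval_mul,
      Polynomial.eval_C]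
    rcases hMn.eq_or_lt with h | h
    · rw [← h]
      simp [hn.ne', hw₀0]
    · have e : w₀ ^ (M - 1) = w₀ ^ n * w₀ ^ (M - n - 1) := by rw [← pow_add]; congr 1; omega
      rw [e, ← hw₀, Nat.cast_sub hMn]
      have : (M : k) * (w₀ ^ n * w₀ ^ (M - n - 1)) - w₀ ^ n * (((M : k) - n) * w₀ ^ (M - n - 1)) =
        n * (w₀ ^ n * w₀ ^ (M - n - 1)) := by ring
      rw [this]
      have : (n : k) ≠ 0 := by exact_mod_cast hn.ne'
      positivity
  obtain ⟨w, hw, hw'⟩ := HenselianRing.is_henselian p hmonic _ hroot hder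
  have hwc : PowerSeries.constantCoeff w = w₀ := by
    rw [Ideal.mem_span_singleton, PowerSeries.X_dvd_iff] at hw'
    simpa [sub_eq_zero] using hw'
  have hwv : w * w⁻¹ = 1 := PowerSeries.mul_inv_cancel _ (by rwa [hwc])
  refine ⟨w⁻¹, ?_, ?_⟩
  · rw [PowerSeries.constantCoeff_inv, hwc]
    exact inv_ne_zero hw₀0
  · have h1 : ∑ j ∈ Finset.range (q.natDegree + 1),
        PowerSeries.C (q.coeff j) * PowerSeries.X ^ j * w ^ (M - j) = w ^ (M - n) := by
      rw [Polynomial.IsRoot.def, hp] at hw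
      simp only [Polynomial.eval_add, Polynomial.eval_sub, Polynomial.eval_finsetSum,
        Polynomial.eval_pow, Polynomial.eval_X, Polynomial.eval_mul, Polynomial.eval_C] at hw
      have h2 := congrArg (fun z => PowerSeries.C (q.coeff 0) * z) hw
      have hq1 : (PowerSeries.C (q.coeff 0) : PowerSeries k) * PowerSeries.C (q.coeff 0)⁻¹ = 1 := by
        rw [← map_mul, mul_inv_cancel₀ hq, map_one]
      simp only [mul_add, mul_sub, Finset.mul_sum, mul_zero, map_mul, ← mul_assoc, hq1, one_mul]
        at h2
      rw [Finset.range_eq_Ico, Finset.sum_eq_sum_Ico_succ_bot (by omega)]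
      rw [← add_sub_assoc, sub_eq_zero] at h2
      have hI : Finset.Ico (0 + 1) (q.natDegree + 1) = Finset.Icc 1 q.natDegree := by
        ext; simp
      rw [hI]
      simpa using h2
    have hu : ∀ j ≤ M, w ^ (M - j) * w⁻¹ ^ M = w⁻¹ ^ j := by
      intro j hj
      have : w⁻¹ ^ M = w⁻¹ ^ (M - j) * w⁻¹ ^ j := by rw [← pow_add]; congr 1; omega
      rw [this, ← mul_assoc, ← mul_pow, hwv, one_pow, one_mul]
    have h2 := congrArg (fun z => z * w⁻¹ ^ M) h1
    simp only [hu n hMn, Finset.sum_mul] at h2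
    rw [← h2, Polynomial.aeval_eq_sum_range]
    refine Finset.sum_congr rfl fun j hj => ?_
    rw [Finset.mem_range] at hj
    rw [mul_assoc, hu j (by omega), PowerSeries.smul_eq_C_mul, mul_pow, mul_assoc]

end Root

/-! ### Puiseux parametrisation of a branch at infinity. -/

section PuiseuxPoint

variable {k : Type*} [Field k]

/-- The map `t ↦ (f t, g t)` has a pole of order `n` at `t = 0`, and its value there is the point
`(1 : 0 : 0)`. -/
structure HorizontalPole (f g : k[T;T⁻¹]) (n : ℕ) (q₁ q₂ : Polynomial k) : Prop where
  pos : 0 < n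
  left : f * LaurentPolynomial.T n = Polynomial.toLaurent q₁
  right : g * LaurentPolynomial.T n = Polynomial.toLaurent q₂
  left_ne : q₁.coeff 0 ≠ 0
  right_eq : q₂.coeff 0 = 0

/-- Clearing denominators: a form of degree i absorbs t^(ni), and t^(n(d-i)) is left over. -/
theorem aeval_sum_homogeneous_mul_T {f g : k[T;T⁻¹]} {n : ℕ} {q₁ q₂ : Polynomial k}
    (hf : f * LaurentPolynomial.T n = Polynomial.toLaurent q₁)
    (hg : g * LaurentPolynomial.T n = Polynomial.toLaurent q₂)
    (H : ℕ → MvPolynomial (Fin 2) k) (hH : ∀ i, (H i).IsHomogeneous i) (d : ℕ) :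
    MvPolynomial.aeval ![f, g] (∑ i ∈ Finset.range (d + 1), H i) *
        LaurentPolynomial.T ((n * d : ℕ) : ℤ) =
      Polynomial.toLaurent (∑ i ∈ Finset.range (d + 1),
        Polynomial.X ^ (n * (d - i)) * MvPolynomial.aeval ![q₁, q₂] (H i)) := by
  rw [map_sum, Finset.sum_mul, map_sum]
  refine Finset.sum_congr rfl fun i hi => ?_
  rw [Finset.mem_range] at hi
  have h1 : Polynomial.toLaurent (MvPolynomial.aeval ![q₁, q₂] (H i)) =
      LaurentPolynomial.T ((n * i : ℕ) : ℤ) * MvPolynomial.aeval ![f, g] (H i) := by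
    rw [← Polynomial.toLaurentAlg_apply, map_aeval_pair, Polynomial.toLaurentAlg_apply,
      Polynomial.toLaurentAlg_apply, ← hf, ← hg, mul_comm f, mul_comm g,
      aeval_mul_of_isHomogeneous (hH i), LaurentPolynomial.T_pow]
    congr 2
    push_cast
    ring
  rw [map_mul, Polynomial.toLaurent_X_pow, h1, ← mul_assoc, ← LaurentPolynomial.T_add, mul_comm]
  congr 2
  rw [← Nat.cast_add, ← Nat.mul_add]
  congr 2
  omega

/-- A branch at the point `(1 : 0 : 0)` has a parametrization `z = u ^ n`, `y = y(u)` by a power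
series, in the affine coordinates `(1 : y : z)`. -/
theorem HorizontalPole.exists_point [IsAlgClosed k] [CharZero k] {f g : k[T;T⁻¹]} {n : ℕ}
    {q₁ q₂ : Polynomial k} (h : HorizontalPole f g n q₁ q₂) :
    ∃ v Q y : PowerSeries k, PowerSeries.constantCoeff v ≠ 0 ∧ PowerSeries.constantCoeff Q ≠ 0 ∧
      PowerSeries.constantCoeff y = 0 ∧
      (PowerSeries.X * v) ^ n = PowerSeries.X ^ n * Q ∧
      ∀ (H : ℕ → MvPolynomial (Fin 2) k) (d : ℕ) (r : Polynomial k),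
        (∀ i, (H i).IsHomogeneous i) →
        MvPolynomial.aeval ![f, g] (∑ i ∈ Finset.range (d + 1), H i) *
          LaurentPolynomial.T ((n * d : ℕ) : ℤ) = Polynomial.toLaurent r →
        Polynomial.aeval (PowerSeries.X * v) r = Q ^ d * (chart H d n).eval y := by
  -- With t = uv the coordinate z = 1/f = tⁿ/q₁(t) becomes exactly uⁿ, and y = g/f = q₂(t)/q₁(t).
  obtain ⟨v, hv, hvn⟩ := exists_pow_eq_aeval_X_mul q₁ n h.pos h.left_ne
  set θ : PowerSeries k := PowerSeries.X * v with hθ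
  have hθ0 : ∀ q : Polynomial k,
      PowerSeries.constantCoeff (Polynomial.aeval θ q) = q.coeff 0 := by
    intro q
    rw [Polynomial.aeval_def, Polynomial.eval₂_eq_eval_map, constantCoeff_eval, hθ, map_mul,
      PowerSeries.constantCoeff_X, zero_mul, ← Polynomial.coeff_zero_eq_eval_zero,
      Polynomial.coeff_map, Polynomial.coeff_map]
    simp
  set Q := Polynomial.aeval θ q₁ with hQ
  have hQ0 : PowerSeries.constantCoeff Q ≠ 0 := by
    rw [hQ, hθ0]
    exact h.left_ne
  have hQy : Q * (Q⁻¹ * Polynomial.aeval θ q₂) = Polynomial.aeval θ q₂ := by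
    rw [← mul_assoc, PowerSeries.mul_inv_cancel _ hQ0, one_mul]
  have hθn : θ ^ n = PowerSeries.X ^ n * Q := by rw [hθ, mul_pow, hvn]
  refine ⟨v, Q, Q⁻¹ * Polynomial.aeval θ q₂, hv, hQ0, ?_, hθn, ?_⟩
  · rw [map_mul, hθ0, h.right_eq, mul_zero]
  · intro H d r hH hr
    rw [aeval_sum_homogeneous_mul_T h.left h.right H hH d] at hr
    rw [← Polynomial.toLaurent_injective hr, map_sum, eval_chart, Finset.mul_sum]
    refine Finset.sum_congr rfl fun i hi => ?_
    rw [Finset.mem_range] at hi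
    rw [map_mul, map_pow, Polynomial.aeval_X, map_aeval_pair, ← hQ, ← hQy,
      aeval_pair_eq_dehomog (hH i), hQy, pow_mul, hθn, mul_pow, ← pow_mul]
    have : Q ^ d = Q ^ (d - i) * Q ^ i := by rw [← pow_add]; congr 1; omega
    rw [this]
    ring

/-- The parametrized affine curve `t ↦ (f t, g t)` in the curve `∑_{i ≤ d} Hᵢ = c`. -/
structure CurveData (H : ℕ → MvPolynomial (Fin 2) k) (d : ℕ) (c : k) (f g : k[T;T⁻¹]) (e : ℤ) :
    Prop where
  eq : MvPolynomial.aeval ![f, g] (∑ i ∈ Finset.range (d + 1), H i) = LaurentPolynomial.C c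
  coord : ∃ R : MvPolynomial (Fin 2) k, MvPolynomial.aeval ![f, g] R = LaurentPolynomial.T 1
  deriv : ∃ l : k, MvPolynomial.aeval ![f, g]
      (MvPolynomial.pderiv 1 (∑ i ∈ Finset.range (d + 1), H i)) =
    LaurentPolynomial.C l * LaurentPolynomial.T e * euler f

/-- Everything the contact argument needs about one branch. Its conjugates under n-th roots of unity
are distinct because the curve is parametrised injectively, and the last clause bounds the order of
F_y along the branch from below. -/
theorem exists_chart_root [IsAlgClosed k] [CharZero k] {H : ℕ → MvPolynomial (Fin 2) k}
    (hH : ∀ i, (H i).IsHomogeneous i) {d : ℕ} (hd : 0 < d) {c : k} {f g : k[T;T⁻¹]} {e : ℤ}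
    (hc : CurveData H d c f g e) {n : ℕ} {q₁ q₂ : Polynomial k}
    (h : HorizontalPole f g n q₁ q₂) :
    ∃ y : PowerSeries k, PowerSeries.constantCoeff y = 0 ∧
      (chart H d n).eval y = PowerSeries.C c * PowerSeries.X ^ (n * d) ∧
      (∀ ζ : k, ζ ^ n = 1 → PowerSeries.rescale ζ y = y → ζ = 1) ∧
      ∀ i, PowerSeries.coeff i ((chart H d n).derivative.eval y) ≠ 0 →
        e + n * ((d : ℤ) - 2) ≤ i := by
  obtain ⟨v, Q, y, hv, hQ, hy, hθ, hmain⟩ := h.exists_point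
  refine ⟨y, hy, ?_, ?_, ?_⟩
  · have h1 := hmain H d (Polynomial.C c * Polynomial.X ^ (n * d)) hH (by
      rw [hc.eq, Polynomial.toLaurent_C_mul_X_pow])
    rw [map_mul, map_pow, Polynomial.aeval_X, Polynomial.aeval_C, pow_mul, hθ, mul_pow,
      ← pow_mul, PowerSeries.algebraMap_eq] at h1
    have hQ' : Q ^ d ≠ 0 := by
      apply pow_ne_zero
      rintro rfl
      simp at hQ
    apply mul_left_cancel₀ hQ'
    rw [← h1]
    ring
  · intro ζ hζ hζy
    -- The parameter t = uv is a polynomial `R` in the coordinates, so it is recovered from `y`. If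
    -- `y` is fixed by u ↦ ζu then so is uv, and its linear coefficient v(0) ≠ 0 gives ζ = 1.
    obtain ⟨R, hR⟩ := hc.coord
    have hRsum := MvPolynomial.sum_homogeneousComponent R
    have h1 := hmain (fun i => MvPolynomial.homogeneousComponent i R) R.totalDegree
      (Polynomial.X ^ (n * R.totalDegree + 1))
      (fun i => MvPolynomial.homogeneousComponent_isHomogeneous i R) (by
        rw [hRsum, hR, Polynomial.toLaurent_X_pow, ← LaurentPolynomial.T_add]
        congr 1
        push_cast
        ring)
    set N := R.totalDegree
    rw [map_pow, Polynomial.aeval_X, pow_succ, pow_mul, hθ, mul_pow, ← pow_mul] at h1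
    have hQ' : Q ^ N ≠ 0 := by
      apply pow_ne_zero
      rintro rfl
      simp at hQ
    have h2 : PowerSeries.X ^ (n * N) * (PowerSeries.X * v) =
        (chart (fun i => MvPolynomial.homogeneousComponent i R) N n).eval y := by
      apply mul_left_cancel₀ hQ'
      rw [← h1]
      ring
    have h3 := congrArg (PowerSeries.rescale ζ) h2
    rw [← Polynomial.eval_map_apply, chart_map_rescale _ _ _ _ hζ, hζy, ← h2, map_mul, map_pow,
      PowerSeries.rescale_X, mul_pow, ← map_pow, pow_mul, hζ, one_pow, map_one, one_mul] at h3
    have h4 := congrArg (PowerSeries.coeff 1) (PowerSeries.X_pow_mul_cancel h3)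
    rw [PowerSeries.coeff_rescale, pow_one, PowerSeries.coeff_succ_X_mul 0,
      PowerSeries.coeff_zero_eq_constantCoeff] at h4
    exact (mul_eq_right₀ hv).mp h4
  · intro i hi
    obtain ⟨l, hl⟩ := hc.deriv
    obtain ⟨d, rfl⟩ : ∃ d', d = d' + 1 := ⟨d - 1, by omega⟩
    by_contra hlt
    push Not at hlt
    -- The exponent is `e - n`, from tᵉ and the pole of `euler f`, plus `n` times the degree of F_y
    -- from clearing denominators. Under the negated bound it exceeds `i`, so it is a natural
    -- number.
    obtain ⟨E, hE⟩ : ∃ E : ℕ, e + n * (((d + 1 : ℕ) : ℤ) - 2) = E :=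
      ⟨_, (Int.toNat_of_nonneg (by omega)).symm⟩
    have hEi : i < E := by omega
    rw [derivative_chart H d n (hH 0)] at hi
    have hder : MvPolynomial.pderiv 1 (∑ i ∈ Finset.range (d + 1 + 1), H i) =
        ∑ i ∈ Finset.range (d + 1), MvPolynomial.pderiv 1 (H (i + 1)) := by
      rw [Finset.sum_range_succ', map_add, map_sum]
      have h0 : MvPolynomial.pderiv 1 (H 0) = 0 := by
        have := hH 0
        rw [← MvPolynomial.totalDegree_zero_iff_isHomogeneous,
          MvPolynomial.totalDegree_eq_zero_iff_eq_C] at this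
        rw [this, MvPolynomial.pderiv_C]
      rw [h0, add_zero]
    have heuler : euler f * LaurentPolynomial.T n = Polynomial.toLaurent
        (Polynomial.X * Polynomial.derivative q₁ - Polynomial.C (n : k) * q₁) := by
      have h2 := congrArg euler h.left
      rw [Derivation.leibniz, euler_T, euler_toLaurent, smul_eq_mul, smul_eq_mul] at h2
      rw [map_sub, ← h2, map_mul, Polynomial.toLaurent_C, ← h.left]
      push_cast
      ring
    have h1 := hmain (fun i => MvPolynomial.pderiv 1 (H (i + 1))) d
      (Polynomial.C l * Polynomial.X ^ E *
        (Polynomial.X * Polynomial.derivative q₁ - Polynomial.C (n : k) * q₁))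
      (fun i => by simpa using (hH (i + 1)).pderiv) (by
        rw [← hder, hl, map_mul, ← heuler, Polynomial.toLaurent_C_mul_X_pow, ← hE]
        push_cast
        have : e + n * ((d : ℤ) + 1 - 2) = e + (n * d - n) := by ring
        rw [this, LaurentPolynomial.T_add, LaurentPolynomial.T_sub]
        have h2 : (LaurentPolynomial.T (-(n : ℤ)) : k[T;T⁻¹]) * LaurentPolynomial.T n = 1 := by
          rw [← LaurentPolynomial.T_add, neg_add_cancel, LaurentPolynomial.T_zero]
        linear_combination (-LaurentPolynomial.C l * LaurentPolynomial.T e * euler f *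
          LaurentPolynomial.T ((n : ℤ) * d)) * h2)
    have h2 : PowerSeries.X ^ E ∣ Q ^ d *
        (chart (fun i => MvPolynomial.pderiv 1 (H (i + 1))) d n).eval y := by
      rw [← h1, map_mul, map_mul, map_pow, Polynomial.aeval_X, mul_pow]
      exact ((dvd_mul_right _ _).mul_left _).mul_right _
    have h3 : IsUnit (Q ^ d) := by
      apply IsUnit.pow
      rw [PowerSeries.isUnit_iff_constantCoeff]
      exact hQ.isUnit
    rw [h3.dvd_mul_left, PowerSeries.X_pow_dvd_iff] at h2
    exact hi (h2 i hEi)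

end PuiseuxPoint

/-! ### Bounds on the pole order and on the exponent e. -/

section Multiplicity

variable {k : Type*} [Field k] [IsAlgClosed k] [CharZero k]

/-- The order of a pole at `(1 : 0 : 0)` is at most the multiplicity of `Y` in the leading form. -/
theorem HorizontalPole.le_of_dehomog_eq {H : ℕ → MvPolynomial (Fin 2) k}
    (hH : ∀ i, (H i).IsHomogeneous i) {d : ℕ} (hd : 0 < d) {c : k} {f g : k[T;T⁻¹]} {e : ℤ}
    (hc : CurveData H d c f g e) {n : ℕ} {q₁ q₂ : Polynomial k}
    (h : HorizontalPole f g n q₁ q₂) {κ : k} (hκ : κ ≠ 0) {b : ℕ}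
    (htop : dehomog (H d) = Polynomial.C κ * Polynomial.X ^ b) : n ≤ b := by
  classical
  obtain ⟨y, hy0, hy, hζ, -⟩ := exists_chart_root hH hd hc h
  set p := chart H d n - Polynomial.C (PowerSeries.C c * PowerSeries.X ^ (n * d)) with hp
  have hpos := h.pos
  have hnd : n * d ≠ 0 := by positivity
  have hpmap : p.map PowerSeries.constantCoeff = Polynomial.C κ * Polynomial.X ^ b := by
    rw [hp, Polynomial.map_sub, chart_map_constantCoeff _ _ _ hpos, htop]
    simp [hnd]
  have hp0 : p ≠ 0 := by
    intro h0
    rw [h0, Polynomial.map_zero] at hpmap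
    exact mul_ne_zero (Polynomial.C_ne_zero.mpr hκ) (pow_ne_zero _ Polynomial.X_ne_zero) hpmap.symm
  have hn0 : NeZero (n : k) := ⟨by exact_mod_cast hpos.ne'⟩
  obtain ⟨ζ₀, hζ₀⟩ := HasEnoughRootsOfUnity.exists_primitiveRoot k n
  set Z := Polynomial.nthRootsFinset n (1 : k) with hZ
  have hZcard : Z.card = n := hζ₀.card_nthRootsFinset
  have hinj : Set.InjOn (fun ζ => PowerSeries.rescale ζ y) (Z : Set k) := by
    intro a ha b hb hab
    have ha' : a ^ n = 1 := (Polynomial.mem_nthRootsFinset hpos _).mp ha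
    have hb' : b ^ n = 1 := (Polynomial.mem_nthRootsFinset hpos _).mp hb
    have hb0 : b ≠ 0 := by
      rintro rfl
      rw [zero_pow hpos.ne'] at hb'
      exact zero_ne_one hb'
    have h1 := congrArg (PowerSeries.rescale b⁻¹) hab
    simp only [PowerSeries.rescale_rescale] at h1
    rw [mul_inv_cancel₀ hb0, PowerSeries.rescale_one, RingHom.id_apply] at h1
    have h2 := hζ (a * b⁻¹) (by rw [mul_pow, inv_pow, ha', hb']; simp) h1
    rw [mul_inv_eq_one₀ hb0] at h2
    exact h2
  set Y := Z.image (fun ζ => PowerSeries.rescale ζ y) with hY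
  have hYcard : Y.card = n := by rw [hY, Finset.card_image_of_injOn hinj, hZcard]
  have hle : Y.val ≤ p.roots := by
    rw [Multiset.le_iff_subset Y.nodup]
    intro z hz
    rw [Finset.mem_val, hY, Finset.mem_image] at hz
    obtain ⟨ζ, hζZ, rfl⟩ := hz
    have hζ' : ζ ^ n = 1 := (Polynomial.mem_nthRootsFinset hpos _).mp hζZ
    rw [Polynomial.mem_roots hp0, Polynomial.IsRoot.def, hp, Polynomial.eval_sub,
      Polynomial.eval_C]
    nth_rw 1 [← chart_map_rescale H d n ζ hζ']
    rw [Polynomial.eval_map_apply, hy, map_mul, rescale_C, map_pow, PowerSeries.rescale_X,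
      mul_pow, ← map_pow, pow_mul, hζ', one_pow, map_one, one_mul, sub_self]
  -- The `n` distinct conjugates all vanish at u = 0, so they split off a factor of `p` that reduces
  -- to `X ^ n`, while `p` itself reduces to κ Xᵇ.
  have hdvd := (Multiset.prod_X_sub_C_dvd_iff_le_roots hp0 _).mpr hle
  have h3 := Polynomial.map_dvd PowerSeries.constantCoeff hdvd
  have h4 : ((Y.val.map fun a => Polynomial.X - Polynomial.C a).prod).map
      PowerSeries.constantCoeff = Polynomial.X ^ n := by
    rw [← Polynomial.coe_mapRingHom, map_multiset_prod, Multiset.map_map, ← hYcard, Finset.card_def,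
      ← Multiset.card_map (fun _ => (Polynomial.X : Polynomial k)), ]
    rw [← Multiset.prod_replicate]
    congr 1
    refine Multiset.eq_replicate.mpr ⟨by simp, ?_⟩
    intro q hq
    rw [Multiset.mem_map] at hq
    obtain ⟨z, hz, rfl⟩ := hq
    rw [Finset.mem_val, hY, Finset.mem_image] at hz
    obtain ⟨ζ, -, rfl⟩ := hz
    have : PowerSeries.constantCoeff (PowerSeries.rescale ζ y) = 0 := by
      rw [← PowerSeries.coeff_zero_eq_constantCoeff_apply, PowerSeries.coeff_rescale,
        PowerSeries.coeff_zero_eq_constantCoeff_apply, hy0, mul_zero]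
    simp [this]
  rw [h4, hpmap] at h3
  rw [(Polynomial.isUnit_C.mpr hκ.isUnit).dvd_mul_left] at h3
  exact (pow_dvd_pow_iff Polynomial.X_ne_zero Polynomial.not_isUnit_X).mp h3

/-- In an infinite family of curves, the exponent `e` of the invariant form is strictly bounded
when the order of the pole and the degree are even. -/
theorem exists_exponent_lt {H : ℕ → MvPolynomial (Fin 2) k}
    (hH : ∀ i, (H i).IsHomogeneous i) {b d : ℕ} (hb : 0 < b) (hbe : Even b) (hd : 0 < d)
    (hde : Even d) {κ : k} (hκ : κ ≠ 0)
    (htop : dehomog (H d) = Polynomial.C κ * Polynomial.X ^ b)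
    (S : Set k) (hS : S.Infinite) (f g : k → k[T;T⁻¹]) (e : k → ℤ)
    (hdata : ∀ c ∈ S, CurveData H d c (f c) (g c) (e c))
    (hpole : ∀ c ∈ S, ∃ q₁ q₂, HorizontalPole (f c) (g c) b q₁ q₂) :
    ∃ c ∈ S, e c < 2 * b - d := by
  have hex : ∀ c ∈ S, ∃ y : PowerSeries k, PowerSeries.constantCoeff y = 0 ∧
      (chart H d b).eval y = PowerSeries.C c * PowerSeries.X ^ (b * d) ∧
      (∀ ζ : k, ζ ^ b = 1 → PowerSeries.rescale ζ y = y → ζ = 1) ∧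
      ∀ i, PowerSeries.coeff i ((chart H d b).derivative.eval y) ≠ 0 →
        e c + b * ((d : ℤ) - 2) ≤ i := by
    intro c hc
    obtain ⟨q₁, q₂, hq⟩ := hpole c hc
    exact exists_chart_root hH hd (hdata c hc) hq
  choose! y hy0 hy hζ hcoef using hex
  obtain ⟨c, hc, i, hi, hne⟩ := exists_order_derivative_lt (chart H d b) κ hκ b d hb hde
    (by rw [chart_map_constantCoeff _ _ _ hb, htop]) (chart_map_rescale _ _ _ _ hbe.neg_one_pow)
    S hS y hy0 hy (by
      intro c hc h
      have := hζ c hc (-1) hbe.neg_one_pow h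
      norm_num at this)
  refine ⟨c, hc, ?_⟩
  -- The two bounds e + b(d - 2) ≤ i < d(b - 1) combine to e < 2b - d.
  have h1 := hcoef c hc i hne
  obtain ⟨b, rfl⟩ : ∃ b', b = b' + 1 := ⟨b - 1, by omega⟩
  have h2 : (i : ℤ) < d * b := by
    rw [Nat.add_sub_cancel] at hi
    exact_mod_cast hi
  push_cast at h1 ⊢
  nlinarith

end Multiplicity

/-! ### Smoothness: the gradient along a parametrised curve. -/

section Smooth

variable {k : Type*} [Field k]

/-- After clearing denominators a unit becomes a divisor of a power of the prime `X` in `k[X]`. -/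
theorem exists_eq_C_mul_T_of_isUnit {p : k[T;T⁻¹]} (hp : IsUnit p) :
    ∃ (l : k) (e : ℤ), p = LaurentPolynomial.C l * LaurentPolynomial.T e := by
  obtain ⟨q, hq⟩ := hp.exists_right_inv
  obtain ⟨m, p', hp'⟩ := LaurentPolynomial.exists_T_pow p
  obtain ⟨m', q', hq'⟩ := LaurentPolynomial.exists_T_pow q
  have h1 : p' * q' = Polynomial.X ^ (m + m') := by
    apply Polynomial.toLaurent_injective
    rw [map_mul, hp', hq', Polynomial.toLaurent_X_pow, mul_mul_mul_comm, hq, one_mul,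
      ← LaurentPolynomial.T_add]
    push_cast
    rfl
  obtain ⟨j, -, hj⟩ := (dvd_prime_pow Polynomial.prime_X _).mp (Dvd.intro _ h1)
  obtain ⟨u, hu⟩ := hj.symm
  obtain ⟨l, hl, hlu⟩ := Polynomial.isUnit_iff.mp u.isUnit
  refine ⟨l, j - m, ?_⟩
  have h2 : p = Polynomial.toLaurent p' * LaurentPolynomial.T (-m) := by
    rw [hp', mul_assoc, ← LaurentPolynomial.T_add, add_neg_cancel, LaurentPolynomial.T_zero,
      mul_one]
  rw [h2, ← hu, ← hlu, map_mul, Polynomial.toLaurent_X_pow, Polynomial.toLaurent_C,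
    LaurentPolynomial.T_sub]
  ring

/-- The map `t ↦ (f t, g t)` is an isomorphism of the punctured line onto the curve `F = 0`. -/
structure IsParam (F : MvPolynomial (Fin 2) k) (f g : k[T;T⁻¹]) : Prop where
  surj : Function.Surjective (MvPolynomial.aeval (R := k) ![f, g])
  ker : ∀ P, MvPolynomial.aeval ![f, g] P = 0 ↔ F ∣ P

-- A good lift is enough here; independence of the lift comes afterwards. Monomials lift to powers
-- of `R` and of a lift `S` of `T⁻¹`, and the congruence for `S` comes from differentiating R S - 1
-- ∈ (F).
open LaurentPolynomial in
theorem IsParam.exists_lift_dvd {F : MvPolynomial (Fin 2) k} {f g : k[T;T⁻¹]} (h : IsParam F f g)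
    {R : MvPolynomial (Fin 2) k} (hR : MvPolynomial.aeval ![f, g] R = T 1) (i : Fin 2)
    {μ : k[T;T⁻¹]} (hμ : μ ∣ MvPolynomial.aeval ![f, g] (MvPolynomial.pderiv i F)) (b : k[T;T⁻¹]) :
    ∃ P : MvPolynomial (Fin 2) k, MvPolynomial.aeval ![f, g] P = b ∧
      μ ∣ MvPolynomial.aeval ![f, g] (MvPolynomial.pderiv i P) * T 1 -
        euler b * MvPolynomial.aeval ![f, g] (MvPolynomial.pderiv i R) := by
  have hF : MvPolynomial.aeval ![f, g] F = 0 := (h.ker F).mpr dvd_rfl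
  obtain ⟨S, hS⟩ := h.surj (T (-1))
  have hT : (T 1 * T (-1) : k[T;T⁻¹]) = 1 := by rw [← T_add]; simp
  have hSd : μ ∣ MvPolynomial.aeval ![f, g] (MvPolynomial.pderiv i S) * T 1 +
      T (-1) * MvPolynomial.aeval ![f, g] (MvPolynomial.pderiv i R) := by
    obtain ⟨G, hG⟩ := (h.ker (R * S - 1)).mp (by simp [hR, hS, hT])
    have h1 := congrArg (fun P => MvPolynomial.aeval ![f, g] (MvPolynomial.pderiv i P)) hG
    simp only [map_sub, MvPolynomial.pderiv_mul, MvPolynomial.pderiv_one, sub_zero, map_add,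
      map_mul, hR, hS, hF, zero_mul, add_zero] at h1
    have h2 : MvPolynomial.aeval ![f, g] (MvPolynomial.pderiv i S) * T 1 +
      T (-1) * MvPolynomial.aeval ![f, g] (MvPolynomial.pderiv i R) =
      MvPolynomial.aeval ![f, g] (MvPolynomial.pderiv i F) * MvPolynomial.aeval ![f, g] G := by
      rw [← h1]; ring
    rw [h2]
    exact hμ.mul_right _
  induction b using LaurentPolynomial.induction_on' with
  | add p q hp hq =>
    obtain ⟨P, rfl, hP⟩ := hp
    obtain ⟨Q, rfl, hQ⟩ := hq
    refine ⟨P + Q, map_add _ _ _, ?_⟩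
    convert dvd_add hP hQ using 1
    simp only [map_add]
    ring
  | C_mul_T n a =>
    have he : euler (C a * T n) = C (n * a) * T n := eulerLinear_C_mul_T a n
    have hTs : ∀ m : ℕ, (T (m + 1 : ℤ) : k[T;T⁻¹]) = T m * T 1 := fun m => T_add _ _
    rcases Int.eq_nat_or_neg n with ⟨m, rfl | rfl⟩
    · refine ⟨MvPolynomial.C a * R ^ m, ?_, ?_⟩
      · rw [map_mul, map_pow, hR, T_pow, mul_one, MvPolynomial.aeval_C]
        rfl
      · rw [he]
        rcases m with _ | m
        · simp
        · rw [MvPolynomial.pderiv_C_mul, MvPolynomial.pderiv_pow]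
          simp only [map_mul, map_pow, hR, T_pow, MvPolynomial.aeval_C, Nat.add_sub_cancel,
            map_natCast, mul_one]
          push_cast
          rw [hTs, ← C_eq_algebraMap]
          simp only [map_add, map_natCast, map_one]
          ring_nf
          simp
    · refine ⟨MvPolynomial.C a * S ^ m, ?_, ?_⟩
      · rw [map_mul, map_pow, hS, T_pow, mul_neg, mul_one, MvPolynomial.aeval_C]
        rfl
      · rw [he]
        rcases m with _ | m
        · simp
        · rw [MvPolynomial.pderiv_C_mul, MvPolynomial.pderiv_pow]
          simp only [map_mul, map_pow, hS, T_pow, MvPolynomial.aeval_C, Nat.add_sub_cancel,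
            map_natCast]
          have h3 : (T (-((m + 1 : ℕ) : ℤ)) : k[T;T⁻¹]) = T (m * -1) * T (-1) := by
            rw [← T_add]; congr 1; push_cast; ring
          rw [h3, ← C_eq_algebraMap]
          obtain ⟨z, hz⟩ := hSd
          refine ⟨C a * ((m + 1 : ℕ) : k[T;T⁻¹]) * T (m * -1) * z, ?_⟩
          have h4 : (C ((-((m + 1 : ℕ) : ℤ) : ℤ) : k) : k[T;T⁻¹]) = -((m + 1 : ℕ) : k[T;T⁻¹]) := by
            simp
          rw [h4]
          linear_combination (C a * ((m + 1 : ℕ) : k[T;T⁻¹]) * T (m * -1)) * hz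

-- Modulo `μ` the derivative ∂ᵢ kills multiples of `F` along the curve, so it descends to a
-- derivation from `k[T;T⁻¹]` to the quotient by `μ`. Such a derivation is determined by its value
-- on `T`.
open LaurentPolynomial in
theorem IsParam.dvd_pderiv {F : MvPolynomial (Fin 2) k} {f g : k[T;T⁻¹]} (h : IsParam F f g)
    {R : MvPolynomial (Fin 2) k} (hR : MvPolynomial.aeval ![f, g] R = T 1) (i : Fin 2)
    {μ : k[T;T⁻¹]} (hμ : μ ∣ MvPolynomial.aeval ![f, g] (MvPolynomial.pderiv i F))
    (P : MvPolynomial (Fin 2) k) :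
    μ ∣ MvPolynomial.aeval ![f, g] (MvPolynomial.pderiv i P) * T 1 -
        euler (MvPolynomial.aeval ![f, g] P) *
          MvPolynomial.aeval ![f, g] (MvPolynomial.pderiv i R) := by
  have hF : MvPolynomial.aeval ![f, g] F = 0 := (h.ker F).mpr dvd_rfl
  obtain ⟨P', hP', hd⟩ := h.exists_lift_dvd hR i hμ (MvPolynomial.aeval ![f, g] P)
  obtain ⟨G, hG⟩ := (h.ker (P - P')).mp (by rw [map_sub, hP', sub_self])
  have h1 : MvPolynomial.aeval ![f, g] (MvPolynomial.pderiv i P) =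
      MvPolynomial.aeval ![f, g] (MvPolynomial.pderiv i P') +
      MvPolynomial.aeval ![f, g] (MvPolynomial.pderiv i F) * MvPolynomial.aeval ![f, g] G := by
    rw [sub_eq_iff_eq_add'.mp hG]
    simp [hF, mul_comm]
  rw [h1, add_mul, add_sub_right_comm]
  exact dvd_add hd ((hμ.mul_right _).mul_right _)

open LaurentPolynomial in
/-- Smoothness of a curve isomorphic to the punctured line: the partial derivatives are those of
the parametrization, up to a unit. -/
theorem IsParam.exists_pderiv_eq {F : MvPolynomial (Fin 2) k} {f g : k[T;T⁻¹]}
    (h : IsParam F f g) : ∃ (l : k) (e : ℤ),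
      MvPolynomial.aeval ![f, g] (MvPolynomial.pderiv 1 F) = C l * T e * euler f ∧
      MvPolynomial.aeval ![f, g] (MvPolynomial.pderiv 0 F) = -(C l * T e * euler g) := by
  have hF : MvPolynomial.aeval ![f, g] F = 0 := (h.ker F).mpr dvd_rfl
  obtain ⟨R, hR⟩ := h.surj (T 1)
  have hT : (T 1 * T (-1) : k[T;T⁻¹]) = 1 := by rw [← T_add]; simp
  have h1 := derivation_aeval_pair euler f g F
  rw [hF, map_zero, smul_eq_mul, smul_eq_mul] at h1
  have h2 := derivation_aeval_pair euler f g R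
  rw [hR, euler_T, Int.cast_one, map_one, one_mul, smul_eq_mul, smul_eq_mul] at h2
  set Fx := MvPolynomial.aeval ![f, g] (MvPolynomial.pderiv 0 F)
  set Fy := MvPolynomial.aeval ![f, g] (MvPolynomial.pderiv 1 F)
  set Rx := MvPolynomial.aeval ![f, g] (MvPolynomial.pderiv 0 R)
  set Ry := MvPolynomial.aeval ![f, g] (MvPolynomial.pderiv 1 R)
  -- Cramer's rule for the system F_x Df + F_y Dg = 0, R_x Df + R_y Dg = T.
  obtain ⟨μ, hμ⟩ : ∃ μ, μ = T (-1) * (Rx * Fy - Ry * Fx) := ⟨_, rfl⟩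
  have hy : Fy = μ * euler f := by
    rw [hμ]
    linear_combination (-Fy) * hT + Fy * T (-1) * h2 - T (-1) * Ry * h1
  have hx : Fx = -(μ * euler g) := by
    rw [hμ]
    linear_combination (-Fx) * hT + Fx * T (-1) * h2 - T (-1) * Rx * h1
  have hμ0 : μ ∣ Fx := ⟨-euler g, by rw [hx]; ring⟩
  have hμ1 : μ ∣ Fy := ⟨euler f, hy⟩
  have a1 := h.dvd_pderiv hR 0 hμ0 (MvPolynomial.X 0)
  have a2 := h.dvd_pderiv hR 0 hμ0 (MvPolynomial.X 1)
  have a3 := h.dvd_pderiv hR 1 hμ1 (MvPolynomial.X 0)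
  have a4 := h.dvd_pderiv hR 1 hμ1 (MvPolynomial.X 1)
  simp only [MvPolynomial.pderiv_X_self, MvPolynomial.aeval_X, map_one, Matrix.cons_val_zero,
    Matrix.cons_val_one, one_mul] at a1 a4
  rw [MvPolynomial.pderiv_X_of_ne (by decide)] at a2 a3
  simp only [MvPolynomial.aeval_X, map_zero, Matrix.cons_val_zero,
    Matrix.cons_val_one, zero_mul, zero_sub, dvd_neg] at a2 a3
  -- Modulo `μ` one has T ≡ Df R_x, T ≡ Dg R_y and Dg R_x ≡ 0, so T² ≡ 0.
  have hunit : IsUnit μ := by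
    refine isUnit_of_dvd_unit ?_ (isUnit_T (R := k) 2)
    have : (T 2 : k[T;T⁻¹]) = T 1 * (T 1 - euler f * Rx) + (euler f * Rx) * (T 1 - euler g * Ry)
        + (euler g * Rx) * (euler f * Ry) := by
      rw [show (2 : ℤ) = 1 + 1 by norm_num, T_add]
      ring
    rw [this]
    exact dvd_add (dvd_add (a1.mul_left _) (a4.mul_left _)) (a2.mul_right _)
  obtain ⟨l, e, rfl⟩ := exists_eq_C_mul_T_of_isUnit hunit
  exact ⟨l, e, hy, hx⟩

end Smooth

/-! ### Coefficients of Laurent polynomials. -/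

section LaurentCoeff

variable {k : Type*} [Field k]

theorem coeff_mul_T (p : k[T;T⁻¹]) (n m : ℤ) :
    (p * LaurentPolynomial.T n).coeff m = p.coeff (m - n) := by
  induction p using LaurentPolynomial.induction_on' with
  | add p q hp hq => simp [add_mul, hp, hq]
  | C_mul_T j a =>
    rw [mul_assoc, ← LaurentPolynomial.T_add, coeff_C_mul_T, coeff_C_mul_T]
    congr 1
    exact propext ⟨fun h => by omega, fun h => by omega⟩

theorem coeff_toLaurent_natCast (q : Polynomial k) (j : ℕ) :
    (Polynomial.toLaurent q).coeff (j : ℤ) = q.coeff j := by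
  induction q using Polynomial.induction_on' with
  | add p q hp hq =>
    rw [map_add, AddMonoidAlgebra.coeff_add, Finsupp.add_apply, hp, hq, Polynomial.coeff_add]
  | monomial n a =>
    rw [← Polynomial.C_mul_X_pow_eq_monomial, Polynomial.toLaurent_C_mul_X_pow, coeff_C_mul_T,
      Polynomial.coeff_C_mul_X_pow]
    congr 1
    exact propext ⟨fun h => by omega, fun h => by omega⟩

theorem exists_toLaurent_eq_mul_T (p : k[T;T⁻¹]) (n : ℕ) (hp : ∀ m : ℤ, m < -n → p.coeff m = 0) :
    ∃ q : Polynomial k, p * LaurentPolynomial.T n = Polynomial.toLaurent q ∧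
      ∀ j : ℕ, q.coeff j = p.coeff (j - n) := by
  obtain ⟨N, p', hp'⟩ := LaurentPolynomial.exists_T_pow p
  have hcoef : ∀ j : ℕ, p'.coeff j = p.coeff (j - N) := fun j => by
    rw [← coeff_toLaurent_natCast, hp', coeff_mul_T]
  obtain ⟨q, hq⟩ : Polynomial.X ^ N ∣ p' * Polynomial.X ^ n := by
    rw [Polynomial.X_pow_dvd_iff]
    intro j hj
    rw [Polynomial.coeff_mul_X_pow']
    split_ifs with h
    · rw [hcoef, hp]
      omega
    · rfl
  have h1 : p * LaurentPolynomial.T n = Polynomial.toLaurent q := by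
    have h2 := congrArg Polynomial.toLaurent hq
    rw [map_mul, map_mul, hp', Polynomial.toLaurent_X_pow, Polynomial.toLaurent_X_pow] at h2
    have h3 : (LaurentPolynomial.T (N : ℤ) : k[T;T⁻¹]) * LaurentPolynomial.T (-(N : ℤ)) = 1 := by
      rw [← LaurentPolynomial.T_add, add_neg_cancel, LaurentPolynomial.T_zero]
    linear_combination (LaurentPolynomial.T (-(N : ℤ))) * h2 -
      (p * LaurentPolynomial.T n - Polynomial.toLaurent q) * h3
  refine ⟨q, h1, fun j => ?_⟩
  rw [← coeff_toLaurent_natCast, ← h1, coeff_mul_T]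

end LaurentCoeff

/-! ### Linear changes of coordinates and inversion of the parameter. -/

section LinearChange

variable {k : Type*} [Field k]

theorem IsParam.of_algEquiv {F : MvPolynomial (Fin 2) k} {f g f' g' : k[T;T⁻¹]}
    (h : IsParam F f g) (σ : MvPolynomial (Fin 2) k ≃ₐ[k] MvPolynomial (Fin 2) k)
    (hσ : ∀ P, MvPolynomial.aeval ![f', g'] (σ P) = MvPolynomial.aeval ![f, g] P) :
    IsParam (σ F) f' g' where
  surj b := by
    obtain ⟨P, hP⟩ := h.surj b
    exact ⟨σ P, by rw [hσ, hP]⟩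
  ker P := by
    obtain ⟨P, rfl⟩ := σ.surjective P
    rw [hσ, h.ker, map_dvd_iff]

theorem IsParam.invert {F : MvPolynomial (Fin 2) k} {f g : k[T;T⁻¹]} (h : IsParam F f g) :
    IsParam F (LaurentPolynomial.invert f) (LaurentPolynomial.invert g) := by
  have hinv : ∀ P, MvPolynomial.aeval ![LaurentPolynomial.invert f, LaurentPolynomial.invert g] P =
      LaurentPolynomial.invert (MvPolynomial.aeval ![f, g] P) := fun P =>
    (map_aeval_pair (LaurentPolynomial.invert (R := k)).toAlgHom f g P).symm
  constructor
  · intro b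
    obtain ⟨P, hP⟩ := h.surj (LaurentPolynomial.invert b)
    exact ⟨P, by rw [hinv, hP, LaurentPolynomial.involutive_invert]⟩
  · intro P
    rw [hinv, map_eq_zero_iff _ (LaurentPolynomial.invert (R := k)).injective, h.ker]

/-- The linear substitution `F(x p + y w)`. -/
def linSubst (p w : Fin 2 → k) : MvPolynomial (Fin 2) k →ₐ[k] MvPolynomial (Fin 2) k :=
  MvPolynomial.aeval ![p 0 • MvPolynomial.X 0 + w 0 • MvPolynomial.X 1,
    p 1 • MvPolynomial.X 0 + w 1 • MvPolynomial.X 1]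

theorem aeval_linSubst {A : Type*} [CommRing A] [Algebra k A] (p w : Fin 2 → k) (x y : A)
    (P : MvPolynomial (Fin 2) k) : MvPolynomial.aeval ![x, y] (linSubst p w P) =
      MvPolynomial.aeval ![p 0 • x + w 0 • y, p 1 • x + w 1 • y] P := by
  rw [linSubst, map_aeval_pair]
  simp

theorem linSubst_isHomogeneous {P : MvPolynomial (Fin 2) k} {i : ℕ} (hP : P.IsHomogeneous i)
    (p w : Fin 2 → k) : (linSubst p w P).IsHomogeneous i := by
  have h1 : ∀ a b : k, (a • MvPolynomial.X 0 + b • MvPolynomial.X 1 :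
      MvPolynomial (Fin 2) k).IsHomogeneous 1 := by
    intro a b
    rw [MvPolynomial.smul_eq_C_mul, MvPolynomial.smul_eq_C_mul]
    exact (MvPolynomial.isHomogeneous_C_mul_X _ _).add (MvPolynomial.isHomogeneous_C_mul_X _ _)
  have h2 := MvPolynomial.IsHomogeneous.aeval hP
    ![p 0 • MvPolynomial.X 0 + w 0 • MvPolynomial.X 1,
      p 1 • MvPolynomial.X 0 + w 1 • MvPolynomial.X 1] (Fin.forall_fin_two.mpr ⟨h1 _ _, h1 _ _⟩)
  rw [one_mul] at h2
  exact h2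

theorem linSubst_linSubst (p w p' w' : Fin 2 → k) (h0 : p 0 * p' 0 + p' 1 * w 0 = 1)
    (h1 : p 0 * w' 0 + w' 1 * w 0 = 0) (h2 : p 1 * p' 0 + p' 1 * w 1 = 0)
    (h3 : p 1 * w' 0 + w' 1 * w 1 = 1) (P : MvPolynomial (Fin 2) k) :
    linSubst p' w' (linSubst p w P) = P := by
  have key : ∀ Q : MvPolynomial (Fin 2) k, linSubst p' w' Q = MvPolynomial.aeval
      ![p' 0 • MvPolynomial.X 0 + w' 0 • MvPolynomial.X 1,
        p' 1 • MvPolynomial.X 0 + w' 1 • MvPolynomial.X 1] Q := fun _ => rfl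
  rw [key, aeval_linSubst]
  conv_rhs => rw [← AlgHom.id_apply (R := k) P, aeval_pair_ext (AlgHom.id k _) P]
  simp only [smul_add, smul_smul, AlgHom.id_apply]
  congr 3
  · rw [add_add_add_comm, ← add_smul, ← add_smul, mul_comm (w 0), h0, mul_comm (w 0), h1]
    simp
  · congr 1
    rw [add_add_add_comm, ← add_smul, ← add_smul, mul_comm (w 1), h2, mul_comm (w 1), h3]
    simp

theorem linSubst_bijective (p w : Fin 2 → k) (h : p 0 * w 1 - p 1 * w 0 ≠ 0) :
    Function.Bijective (linSubst p w) := by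
  set D := p 0 * w 1 - p 1 * w 0 with hD
  set p' : Fin 2 → k := ![w 1 / D, -p 1 / D]
  set w' : Fin 2 → k := ![-w 0 / D, p 0 / D]
  constructor
  · refine Function.LeftInverse.injective (g := linSubst p' w') ?_
    apply linSubst_linSubst <;> simp [p', w'] <;> field_simp <;> rw [hD] <;> ring
  · refine Function.RightInverse.surjective (g := linSubst p' w') ?_
    apply linSubst_linSubst <;> simp [p', w'] <;> field_simp <;> rw [hD] <;> ring

/-- An invertible linear substitution as an automorphism of the polynomial ring. -/
def linEquiv (p w : Fin 2 → k) (h : p 0 * w 1 - p 1 * w 0 ≠ 0) :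
    MvPolynomial (Fin 2) k ≃ₐ[k] MvPolynomial (Fin 2) k :=
  AlgEquiv.ofBijective (linSubst p w) (linSubst_bijective p w h)

/-- The new parametrisation consists of the coordinates of (f, g) in the basis `p`, `w`, by Cramer's
rule. -/
theorem IsParam.linSubst {F : MvPolynomial (Fin 2) k} {f g : k[T;T⁻¹]} (h : IsParam F f g)
    (p w : Fin 2 → k) (hD : p 0 * w 1 - p 1 * w 0 ≠ 0) :
    IsParam (linSubst p w F)
      ((p 0 * w 1 - p 1 * w 0)⁻¹ • (w 1 • f - w 0 • g))
      ((p 0 * w 1 - p 1 * w 0)⁻¹ • (p 0 • g - p 1 • f)) := by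
  refine h.of_algEquiv (linEquiv p w hD) fun P => ?_
  rw [linEquiv, AlgEquiv.coe_ofBijective, aeval_linSubst]
  set D := p 0 * w 1 - p 1 * w 0 with hDdef
  have h1 : ∀ z : k[T;T⁻¹], D⁻¹ • (D • z) = z := fun z => by
    rw [smul_smul, inv_mul_cancel₀ hD, one_smul]
  congr 3
  · conv_rhs => rw [← h1 f]
    rw [hDdef]
    module
  · congr 1
    conv_rhs => rw [← h1 g]
    rw [hDdef]
    module

end LinearChange

/-! ### Intersection with a line, counted in two ways. -/

section Degree

variable {k : Type*} [Field k]

theorem exists_eq_aeval_add_X_mul (P : MvPolynomial (Fin 2) k) :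
    ∃ Q : MvPolynomial (Fin 2) k, P = Polynomial.aeval (MvPolynomial.X 1 : MvPolynomial (Fin 2) k)
      (MvPolynomial.aeval ![(0 : Polynomial k), Polynomial.X] P) + MvPolynomial.X 0 * Q := by
  induction P using MvPolynomial.induction_on with
  | C a => exact ⟨0, by simp⟩
  | add P Q hP hQ =>
    obtain ⟨P', hP⟩ := hP
    obtain ⟨Q', hQ⟩ := hQ
    refine ⟨P' + Q', ?_⟩
    rw [map_add, map_add]
    linear_combination hP + hQ
  | mul_X P i hP =>
    obtain ⟨P', hP⟩ := hP
    fin_cases i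
    · exact ⟨P, by simp [mul_comm]⟩
    · refine ⟨P' * MvPolynomial.X 1, ?_⟩
      simp only [Fin.mk_one, map_mul, MvPolynomial.aeval_X, Matrix.cons_val_one,
        Matrix.cons_val_fin_one, Polynomial.aeval_X]
      linear_combination (MvPolynomial.X 1) * hP

theorem span_singleton_finrank_eq {A : Type*} [CommRing A] [Algebra k A] (I : Ideal A) (a : A)
    (q : Polynomial k) (hsurj : ∀ b : A, ∃ s : Polynomial k, b - Polynomial.aeval a s ∈ I)
    (hker : ∀ s : Polynomial k, Polynomial.aeval a s ∈ I ↔ q ∣ s) :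
    Module.finrank k (A ⧸ I) = q.natDegree := by
  let φ : Polynomial k →ₐ[k] A ⧸ I := (Ideal.Quotient.mkₐ k I).comp (Polynomial.aeval a)
  have hφ : Function.Surjective φ := by
    intro b
    obtain ⟨b, rfl⟩ := Ideal.Quotient.mk_surjective b
    obtain ⟨s, hs⟩ := hsurj b
    exact ⟨s, (Ideal.Quotient.eq.mpr hs).symm⟩
  have hk : RingHom.ker φ = Ideal.span {q} := by
    ext s
    rw [RingHom.mem_ker, Ideal.mem_span_singleton, ← hker]
    exact Ideal.Quotient.eq_zero_iff_mem
  rw [← finrank_quotient_span_eq_natDegree, ← hk]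
  exact (Ideal.quotientKerAlgEquivOfSurjective hφ).toLinearEquiv.finrank_eq.symm

/-- The number of intersection points of the curve with the line `x = 0`, counted by means of the
equation and by means of the parametrization. -/
theorem IsParam.natDegree_eq {F : MvPolynomial (Fin 2) k} {f g : k[T;T⁻¹]} (h : IsParam F f g)
    {n : ℕ} {q : Polynomial k} (hq : f * LaurentPolynomial.T n = Polynomial.toLaurent q)
    (hq0 : q.coeff 0 ≠ 0) :
    (MvPolynomial.aeval ![(0 : Polynomial k), Polynomial.X] F).natDegree = q.natDegree := by
  have hF : MvPolynomial.aeval ![f, g] F = 0 := (h.ker F).mpr dvd_rfl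
  have hev : ∀ s : Polynomial k, MvPolynomial.aeval ![f, g]
      (Polynomial.aeval (MvPolynomial.X 1 : MvPolynomial (Fin 2) k) s) = Polynomial.aeval g s := by
    intro s
    rw [← Polynomial.aeval_algHom_apply]
    simp
  have hTT : (LaurentPolynomial.T (n : ℤ) : k[T;T⁻¹]) * LaurentPolynomial.T (-(n : ℤ)) = 1 := by
    rw [← LaurentPolynomial.T_add, add_neg_cancel, LaurentPolynomial.T_zero]
  have hspan : ∀ b : k[T;T⁻¹], f ∣ b ↔ Polynomial.toLaurent q ∣ b := by
    intro b
    rw [← hq, (LaurentPolynomial.isUnit_T (n : ℤ)).mul_right_dvd]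
  have hcop : ∀ N, IsCoprime q (Polynomial.X ^ N) := by
    intro N
    refine IsCoprime.pow_right ?_
    rw [isCoprime_comm]
    refine (Polynomial.prime_X.irreducible.coprime_iff_not_dvd).mpr ?_
    rwa [Polynomial.X_dvd_iff]
  have haT : ∀ s : Polynomial k, Polynomial.aeval (LaurentPolynomial.T 1 : k[T;T⁻¹]) s =
      Polynomial.toLaurent s := by
    intro s
    rw [← Polynomial.toLaurent_X, ← Polynomial.toLaurentAlg_apply,
      Polynomial.aeval_algHom_apply, Polynomial.aeval_X_left_apply]
    rfl
  -- The quotient of `k[T;T⁻¹]` by `f` is generated by `g` with relation F(0, Y), and also by `T`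
  -- with relation `q`. Both degrees equal its dimension.
  rw [← span_singleton_finrank_eq (Ideal.span {f}) g, ← span_singleton_finrank_eq (Ideal.span {f})
    (LaurentPolynomial.T 1 : k[T;T⁻¹])]
  · intro b
    obtain ⟨N, r, hr⟩ := LaurentPolynomial.exists_T_pow b
    obtain ⟨a, c, hac⟩ := hcop N
    refine ⟨c * r, ?_⟩
    rw [Ideal.mem_span_singleton, hspan, haT]
    refine ⟨b * Polynomial.toLaurent a, ?_⟩
    have h1 := congrArg Polynomial.toLaurent hac
    rw [map_add, map_mul, map_mul, map_one, Polynomial.toLaurent_X_pow] at h1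
    rw [map_mul, hr]
    linear_combination (-b) * h1
  · intro s
    rw [Ideal.mem_span_singleton, hspan, haT]
    constructor
    · rintro ⟨b, hb⟩
      obtain ⟨N, r, hr⟩ := LaurentPolynomial.exists_T_pow b
      refine (hcop N).dvd_of_dvd_mul_right ⟨r, ?_⟩
      apply Polynomial.toLaurent_injective
      rw [map_mul, map_mul, Polynomial.toLaurent_X_pow, hr, hb, mul_assoc]
    · rintro ⟨r, rfl⟩
      rw [map_mul]
      exact dvd_mul_right _ _
  · intro b
    obtain ⟨P, rfl⟩ := h.surj b
    obtain ⟨Q, hQ⟩ := exists_eq_aeval_add_X_mul P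
    refine ⟨MvPolynomial.aeval ![(0 : Polynomial k), Polynomial.X] P, ?_⟩
    rw [Ideal.mem_span_singleton]
    refine ⟨MvPolynomial.aeval ![f, g] Q, ?_⟩
    conv_lhs => enter [1]; rw [hQ]
    rw [map_add, hev, map_mul]
    simp
  · intro s
    rw [Ideal.mem_span_singleton]
    constructor
    · rintro ⟨b, hb⟩
      obtain ⟨Q, rfl⟩ := h.surj b
      have h1 : MvPolynomial.aeval ![f, g] (Polynomial.aeval
          (MvPolynomial.X 1 : MvPolynomial (Fin 2) k) s - MvPolynomial.X 0 * Q) = 0 := by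
        rw [map_sub, hev, hb]
        simp
      have h2 := map_dvd (MvPolynomial.aeval ![(0 : Polynomial k), Polynomial.X])
        ((h.ker _).mp h1)
      rw [map_sub, ← Polynomial.aeval_algHom_apply] at h2
      simpa using h2
    · rintro ⟨r, rfl⟩
      obtain ⟨Q, hQ⟩ := exists_eq_aeval_add_X_mul F
      have h1 := congrArg (MvPolynomial.aeval ![f, g]) hQ
      rw [hF, map_add, hev, map_mul] at h1
      simp only [MvPolynomial.aeval_X, Matrix.cons_val_zero] at h1
      rw [map_mul]
      exact Dvd.dvd.mul_right ⟨-MvPolynomial.aeval ![f, g] Q, by linear_combination -h1⟩ _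

end Degree

/-! ### Poles of a parametrisation and their leading coefficients. -/

section Pole

variable {k : Type*} [Field k]

/-- The map `t ↦ (f t, g t)` has a pole of order `n` at `t = 0` with leading coefficient `v`. -/
structure HasPole (f g : k[T;T⁻¹]) (n : ℕ) (v : Fin 2 → k) : Prop where
  pos : 0 < n
  left_zero : ∀ m : ℤ, m < -n → f.coeff m = 0
  right_zero : ∀ m : ℤ, m < -n → g.coeff m = 0
  left : f.coeff (-n) = v 0
  right : g.coeff (-n) = v 1
  ne : v ≠ 0

theorem HasPole.exists_polynomial {f g : k[T;T⁻¹]} {n : ℕ} {v : Fin 2 → k} (h : HasPole f g n v) :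
    ∃ q₁ q₂ : Polynomial k, f * LaurentPolynomial.T n = Polynomial.toLaurent q₁ ∧
      g * LaurentPolynomial.T n = Polynomial.toLaurent q₂ ∧ q₁.coeff 0 = v 0 ∧
      q₂.coeff 0 = v 1 := by
  obtain ⟨q₁, h1, h1'⟩ := exists_toLaurent_eq_mul_T f n h.left_zero
  obtain ⟨q₂, h2, h2'⟩ := exists_toLaurent_eq_mul_T g n h.right_zero
  refine ⟨q₁, q₂, h1, h2, ?_, ?_⟩
  · rw [h1', ← h.left]; simp
  · rw [h2', ← h.right]; simp

theorem HasPole.exists_horizontalPole {f g : k[T;T⁻¹]} {n : ℕ} {v : Fin 2 → k}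
    (h : HasPole f g n v) (hv : v 1 = 0) : ∃ q₁ q₂, HorizontalPole f g n q₁ q₂ := by
  obtain ⟨q₁, q₂, h1, h2, h3, h4⟩ := h.exists_polynomial
  refine ⟨q₁, q₂, h.pos, h1, h2, ?_, by rw [h4, hv]⟩
  rw [h3]
  intro h0
  exact h.ne (funext (Fin.forall_fin_two.mpr ⟨h0, hv⟩))

end Pole

section PoleOrder

variable {k : Type} [Field k]

theorem coeff_eq_zero_of_lt_poleOrder (f g : k[T;T⁻¹]) {m : ℤ} (hm : m < -(poleOrder f g : ℤ)) :
    f.coeff m = 0 ∧ g.coeff m = 0 := by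
  by_contra h
  have hmem : m ∈ f.coeff.support ∪ g.coeff.support := by
    rw [Finset.mem_union, Finsupp.mem_support_iff, Finsupp.mem_support_iff]
    tauto
  have := Finset.le_sup (f := fun n : ℤ => (-n).toNat) hmem
  have h2 : (-m).toNat ≤ poleOrder f g := this
  omega

/-- The pole order is positive: otherwise f and g, and so every polynomial in them, would lie in
`k[T]`, although `T⁻¹` is such a polynomial. -/
theorem IsParam.hasPole_poleOrder {F : MvPolynomial (Fin 2) k} {f g : k[T;T⁻¹]}
    (h : IsParam F f g) : HasPole f g (poleOrder f g)
      ![f.coeff (-(poleOrder f g : ℤ)), g.coeff (-(poleOrder f g : ℤ))] := by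
  have hpos : 0 < poleOrder f g := by
    rw [Nat.pos_iff_ne_zero]
    intro h0
    have hz : ∀ m : ℤ, m < -((0 : ℕ) : ℤ) → f.coeff m = 0 ∧ g.coeff m = 0 := fun m hm =>
      coeff_eq_zero_of_lt_poleOrder f g (by rwa [h0])
    obtain ⟨q₁, h1, -⟩ := exists_toLaurent_eq_mul_T f 0 fun m hm => (hz m hm).1
    obtain ⟨q₂, h2, -⟩ := exists_toLaurent_eq_mul_T g 0 fun m hm => (hz m hm).2
    rw [Nat.cast_zero, LaurentPolynomial.T_zero, mul_one] at h1 h2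
    obtain ⟨P, hP⟩ := h.surj (LaurentPolynomial.T (-1))
    have h3 := map_aeval_pair Polynomial.toLaurentAlg q₁ q₂ P
    rw [Polynomial.toLaurentAlg_apply, Polynomial.toLaurentAlg_apply,
      Polynomial.toLaurentAlg_apply, ← h1, ← h2, hP] at h3
    have h4 : Polynomial.toLaurent (Polynomial.X * MvPolynomial.aeval ![q₁, q₂] P) = 1 := by
      rw [map_mul, h3, Polynomial.toLaurent_X, ← LaurentPolynomial.T_add]
      simp
    rw [← map_one Polynomial.toLaurent] at h4
    exact Polynomial.not_isUnit_X (IsUnit.of_mul_eq_one _ (Polynomial.toLaurent_injective h4))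
  refine ⟨hpos, fun m hm => (coeff_eq_zero_of_lt_poleOrder f g hm).1,
    fun m hm => (coeff_eq_zero_of_lt_poleOrder f g hm).2, rfl, rfl, fun h0 => ?_⟩
  apply leadingVector_ne_zero f g
  have h1 := congrFun h0 0
  have h2 := congrFun h0 1
  simp only [Matrix.cons_val_zero, Matrix.cons_val_one, Matrix.cons_val_fin_one,
    Pi.zero_apply] at h1 h2
  rw [leadingVector, h1, h2, if_neg hpos.ne']
  funext i
  fin_cases i <;> rfl

end PoleOrder

/-! ### Degree and zeros of the leading form. -/

section Leading

variable {k : Type*} [Field k]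

/-- The leading form vanishes at the leading coefficient of a pole. -/
theorem HasPole.aeval_leading_eq_zero {H : ℕ → MvPolynomial (Fin 2) k}
    (hH : ∀ i, (H i).IsHomogeneous i) {d : ℕ} (hd : 0 < d) {c : k} {f g : k[T;T⁻¹]}
    (heq : MvPolynomial.aeval ![f, g] (∑ i ∈ Finset.range (d + 1), H i) = LaurentPolynomial.C c)
    {n : ℕ} {v : Fin 2 → k} (h : HasPole f g n v) :
    MvPolynomial.aeval ![v 0, v 1] (H d) = 0 := by
  obtain ⟨q₁, q₂, h1, h2, h3, h4⟩ := h.exists_polynomial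
  have h5 := aeval_sum_homogeneous_mul_T h1 h2 H hH d
  rw [heq, ← Polynomial.toLaurent_C_mul_X_pow] at h5
  have h6 := congrArg (Polynomial.aeval (0 : k)) (Polynomial.toLaurent_injective h5)
  have hpos := h.pos
  have hnd : n * d ≠ 0 := by positivity
  rw [map_sum, Finset.sum_range_succ, Finset.sum_eq_zero] at h6
  · rw [map_mul, map_mul, map_aeval_pair] at h6
    simp only [Polynomial.aeval_X_pow, zero_pow hnd, mul_zero, Nat.sub_self, pow_zero, one_mul,
      zero_add, ← Polynomial.coeff_zero_eq_aeval_zero, h3, h4,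
      Polynomial.coeff_one_zero] at h6
    exact h6.symm
  · intro i hi
    rw [Finset.mem_range] at hi
    have : n * (d - i) ≠ 0 := by
      have : 0 < d - i := by omega
      positivity
    rw [map_mul, Polynomial.aeval_X_pow, zero_pow this, zero_mul]

theorem IsParam.aeval_sum {H : ℕ → MvPolynomial (Fin 2) k} {d : ℕ} {c : k} {f g : k[T;T⁻¹]}
    (h : IsParam (∑ i ∈ Finset.range (d + 1), H i - MvPolynomial.C c) f g) :
    MvPolynomial.aeval ![f, g] (∑ i ∈ Finset.range (d + 1), H i) = LaurentPolynomial.C c := by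
  have := (h.ker _).mpr dvd_rfl
  rw [map_sub, sub_eq_zero, MvPolynomial.aeval_C] at this
  exact this

theorem natDegree_mul_T_eq {p : k[T;T⁻¹]} {n n' : ℕ} {q : Polynomial k}
    (hq : p * LaurentPolynomial.T n = Polynomial.toLaurent q)
    (htop : ∀ m : ℤ, n' < m → p.coeff m = 0) (hne : p.coeff n' ≠ 0) :
    q.natDegree = n + n' := by
  have hc : ∀ j : ℕ, q.coeff j = p.coeff (j - n) := fun j => by
    rw [← coeff_toLaurent_natCast, ← hq, coeff_mul_T]
  apply Polynomial.natDegree_eq_of_le_of_coeff_ne_zero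
  · rw [Polynomial.natDegree_le_iff_coeff_eq_zero]
    intro j hj
    rw [hc]
    apply htop
    omega
  · rw [hc]
    convert hne using 2
    push_cast
    ring

/-- The line through 0 spanned by `w` meets the curve where w₁ f - w₀ g vanishes. By the conditions
on `w`, neither extreme term, in degrees `-n` and `n'`, cancels. -/
theorem IsParam.natDegree_line {F : MvPolynomial (Fin 2) k} {f g : k[T;T⁻¹]} (h : IsParam F f g)
    {n n' : ℕ} {v v' : Fin 2 → k} (hv : HasPole f g n v)
    (hv' : HasPole (LaurentPolynomial.invert f) (LaurentPolynomial.invert g) n' v')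
    (w : Fin 2 → k) (hw : w 1 * v 0 - w 0 * v 1 ≠ 0) (hw' : w 1 * v' 0 - w 0 * v' 1 ≠ 0) :
    (MvPolynomial.aeval ![w 0 • (Polynomial.X : Polynomial k), w 1 • Polynomial.X] F).natDegree =
      n + n' := by
  obtain ⟨p, hp⟩ : ∃ p : Fin 2 → k, p 0 * w 1 - p 1 * w 0 ≠ 0 := by
    by_cases h0 : w 0 = 0
    · refine ⟨![1, 0], ?_⟩
      have : w 1 ≠ 0 := by
        rintro h1
        simp [h0, h1] at hw
      simpa
    · exact ⟨![0, 1], by simpa using h0⟩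
  have hlin := h.linSubst p w hp
  set D := p 0 * w 1 - p 1 * w 0
  have hcoef : ∀ m : ℤ, (D⁻¹ • (w 1 • f - w 0 • g)).coeff m =
      D⁻¹ * (w 1 * f.coeff m - w 0 * g.coeff m) := fun m => by
    simp
  have hinv : ∀ m : ℤ, (n' : ℤ) < m → f.coeff m = 0 ∧ g.coeff m = 0 := by
    intro m hm
    have h1 := hv'.left_zero (-m) (by omega)
    have h2 := hv'.right_zero (-m) (by omega)
    rw [LaurentPolynomial.invert_apply, neg_neg] at h1 h2
    exact ⟨h1, h2⟩
  have hinv' : f.coeff n' = v' 0 ∧ g.coeff n' = v' 1 := by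
    have h1 := hv'.left
    have h2 := hv'.right
    rw [LaurentPolynomial.invert_apply, neg_neg] at h1 h2
    exact ⟨h1, h2⟩
  obtain ⟨q, hq, hqc⟩ := exists_toLaurent_eq_mul_T (D⁻¹ • (w 1 • f - w 0 • g)) n (by
    intro m hm
    rw [hcoef, hv.left_zero m hm, hv.right_zero m hm]
    simp)
  have hq0 : q.coeff 0 ≠ 0 := by
    rw [hqc, hcoef, Nat.cast_zero, zero_sub, hv.left, hv.right]
    exact mul_ne_zero (inv_ne_zero hp) hw
  have hdeg := hlin.natDegree_eq hq hq0
  rw [aeval_linSubst] at hdeg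
  simp only [smul_zero, zero_add] at hdeg
  rw [hdeg]
  refine natDegree_mul_T_eq hq ?_ ?_
  · intro m hm
    rw [hcoef, (hinv m hm).1, (hinv m hm).2]
    simp
  · rw [hcoef, hinv'.1, hinv'.2]
    exact mul_ne_zero (inv_ne_zero hp) hw'

theorem coeff_aeval_line {H : ℕ → MvPolynomial (Fin 2) k}
    (hH : ∀ i, (H i).IsHomogeneous i) (d : ℕ) (c : k) (w : Fin 2 → k) {j : ℕ} (hj : 0 < j) :
    (MvPolynomial.aeval ![w 0 • (Polynomial.X : Polynomial k), w 1 • Polynomial.X]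
      (∑ i ∈ Finset.range (d + 1), H i - MvPolynomial.C c)).coeff j =
    if j ≤ d then MvPolynomial.aeval ![w 0, w 1] (H j) else 0 := by
  have h1 : ∀ i, MvPolynomial.aeval
      ![w 0 • (Polynomial.X : Polynomial k), w 1 • Polynomial.X] (H i) =
      Polynomial.C (MvPolynomial.aeval ![w 0, w 1] (H i)) * Polynomial.X ^ i := by
    intro i
    have h2 := aeval_mul_of_isHomogeneous (hH i) (Polynomial.X : Polynomial k)
      (Polynomial.C (w 0)) (Polynomial.C (w 1))
    have h3 := map_aeval_pair (Algebra.ofId k (Polynomial k)) (w 0) (w 1) (H i)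
    rw [Polynomial.smul_eq_C_mul, Polynomial.smul_eq_C_mul, mul_comm, mul_comm (Polynomial.C (w 1)),
      h2, mul_comm]
    congr 1
    exact h3.symm
  rw [map_sub, map_sum, MvPolynomial.aeval_C, Polynomial.coeff_sub, Polynomial.finsetSum_coeff]
  simp only [h1, Polynomial.coeff_C_mul_X_pow]
  rw [Finset.sum_ite_eq, Polynomial.algebraMap_eq, Polynomial.coeff_C_of_ne_zero hj.ne', sub_zero]
  simp

/-- The degree of the curve is the sum of the orders of its poles, and the leading form vanishes
only at the leading coefficients of the poles. -/
theorem IsParam.add_eq_degree [Infinite k] {H : ℕ → MvPolynomial (Fin 2) k}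
    (hH : ∀ i, (H i).IsHomogeneous i) {d : ℕ} (hd : 0 < d) (hHd : H d ≠ 0) {c : k}
    {f g : k[T;T⁻¹]} (h : IsParam (∑ i ∈ Finset.range (d + 1), H i - MvPolynomial.C c) f g)
    {n n' : ℕ} {v v' : Fin 2 → k} (hv : HasPole f g n v)
    (hv' : HasPole (LaurentPolynomial.invert f) (LaurentPolynomial.invert g) n' v') :
    n + n' = d ∧ ∀ w : Fin 2 → k, w 1 * v 0 - w 0 * v 1 ≠ 0 → w 1 * v' 0 - w 0 * v' 1 ≠ 0 →
      MvPolynomial.aeval ![w 0, w 1] (H d) ≠ 0 := by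
  have hL : ∀ u : Fin 2 → k, u ≠ 0 → (MvPolynomial.C (u 0) * MvPolynomial.X 1 -
      MvPolynomial.C (u 1) * MvPolynomial.X 0 : MvPolynomial (Fin 2) k) ≠ 0 := by
    intro u hu h0
    have h1 := congrArg (MvPolynomial.eval ![0, 1]) h0
    have h2 := congrArg (MvPolynomial.eval ![1, 0]) h0
    simp at h1 h2
    exact hu (funext (Fin.forall_fin_two.mpr ⟨h1, h2⟩))
  have hprod := mul_ne_zero (mul_ne_zero hHd (hL v hv.ne)) (hL v' hv'.ne)
  -- A generic direction: over an infinite field the nonzero product does not vanish everywhere.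
  obtain ⟨w, hw⟩ : ∃ w : Fin 2 → k, MvPolynomial.eval w (H d *
      (MvPolynomial.C (v 0) * MvPolynomial.X 1 - MvPolynomial.C (v 1) * MvPolynomial.X 0) *
      (MvPolynomial.C (v' 0) * MvPolynomial.X 1 - MvPolynomial.C (v' 1) * MvPolynomial.X 0)) ≠ 0 := by
    by_contra! hall
    exact hprod (MvPolynomial.funext fun w => by rw [hall w, map_zero])
  have hw2 : (![w 0, w 1] : Fin 2 → k) = w := by
    funext i; fin_cases i <;> rfl
  simp only [map_mul, map_sub, MvPolynomial.eval_C, MvPolynomial.eval_X, mul_ne_zero_iff] at hw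
  obtain ⟨⟨hw0, hw1⟩, hw3⟩ := hw
  have hline : ∀ w : Fin 2 → k, w 1 * v 0 - w 0 * v 1 ≠ 0 → w 1 * v' 0 - w 0 * v' 1 ≠ 0 → _ :=
    fun w a b => h.natDegree_line hv hv' w a b
  have hnn : n + n' = d := by
    rw [← hline w (by convert hw1 using 1; ring) (by convert hw3 using 1; ring)]
    apply Polynomial.natDegree_eq_of_le_of_coeff_ne_zero
    · rw [Polynomial.natDegree_le_iff_coeff_eq_zero]
      intro j hj
      rw [coeff_aeval_line hH d c w (by omega), if_neg (by omega)]
    · rw [coeff_aeval_line hH d c w hd, if_pos le_rfl, hw2, MvPolynomial.aeval_eq_eval]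
      exact hw0
  -- Conversely, on every line avoiding the two pole directions the restricted degree is still n +
  -- n' = d, so its coefficient of degree d, which is H_d(w), is nonzero.
  refine ⟨hnn, fun w a b => ?_⟩
  have h1 := hline w a b
  rw [hnn] at h1
  have h2 := coeff_aeval_line hH d c w hd
  rw [if_pos le_rfl] at h2
  rw [← h2]
  intro h0
  rw [← congrArg (Polynomial.coeff _) h1, Polynomial.coeff_natDegree,
    Polynomial.leadingCoeff_eq_zero] at h0
  rw [h0, Polynomial.natDegree_zero] at h1
  omega

end Leading

/-! ### Exchange of the two points at infinity. -/

section Swap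

variable {k : Type*} [Field k]

/-- The exchange of the two variables. -/
def swapVars : MvPolynomial (Fin 2) k ≃ₐ[k] MvPolynomial (Fin 2) k :=
  linEquiv ![0, 1] ![1, 0] (by simp)

theorem aeval_swapVars {A : Type*} [CommRing A] [Algebra k A] (x y : A)
    (P : MvPolynomial (Fin 2) k) :
    MvPolynomial.aeval ![x, y] (swapVars P) = MvPolynomial.aeval ![y, x] P := by
  have : swapVars P = linSubst ![0, 1] ![1, 0] P := rfl
  rw [this, aeval_linSubst]
  simp

theorem swapVars_isHomogeneous {P : MvPolynomial (Fin 2) k} {i : ℕ} (hP : P.IsHomogeneous i) :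
    (swapVars P).IsHomogeneous i :=
  linSubst_isHomogeneous hP _ _

theorem pderiv_swapVars (P : MvPolynomial (Fin 2) k) :
    MvPolynomial.pderiv 1 (swapVars P) = swapVars (MvPolynomial.pderiv 0 P) := by
  have h : ∀ Q : MvPolynomial (Fin 2) k, swapVars Q =
      MvPolynomial.aeval ![MvPolynomial.X 1, MvPolynomial.X 0] Q := by
    intro Q
    have : swapVars Q = linSubst ![0, 1] ![1, 0] Q := rfl
    rw [this, linSubst]
    simp
  rw [h, h, derivation_aeval_pair]
  simp

/-- Swapping the variables exchanges F_x and F_y, and inverting t turns tᵉ into t⁻ᵉ. The sign of F_x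
is absorbed by `euler_invert`, so both ends fit the same structure with opposite exponents. -/
theorem IsParam.curveData {H : ℕ → MvPolynomial (Fin 2) k} {d : ℕ} {c : k} {f g : k[T;T⁻¹]}
    (h : IsParam (∑ i ∈ Finset.range (d + 1), H i - MvPolynomial.C c) f g) :
    ∃ e : ℤ, CurveData H d c f g e ∧
      CurveData (fun i => swapVars (H i)) d c (LaurentPolynomial.invert g)
        (LaurentPolynomial.invert f) (-e) := by
  obtain ⟨l, e, h1, h0⟩ := h.exists_pderiv_eq
  rw [map_sub, MvPolynomial.pderiv_C, sub_zero] at h0 h1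
  have hinv : ∀ P : MvPolynomial (Fin 2) k,
      MvPolynomial.aeval ![LaurentPolynomial.invert g, LaurentPolynomial.invert f]
      (swapVars P) = LaurentPolynomial.invert (MvPolynomial.aeval ![f, g] P) := fun P => by
    rw [aeval_swapVars]
    exact (map_aeval_pair (LaurentPolynomial.invert (R := k)).toAlgHom f g P).symm
  refine ⟨e, ⟨h.aeval_sum, h.surj _, l, h1⟩, ⟨?_, ?_, -(-l), ?_⟩⟩
  · rw [← map_sum, hinv, h.aeval_sum, LaurentPolynomial.invert_C]
  · obtain ⟨R, hR⟩ := h.surj (LaurentPolynomial.T (-1))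
    exact ⟨swapVars R, by rw [hinv, hR, LaurentPolynomial.invert_T, neg_neg]⟩
  · rw [← map_sum, pderiv_swapVars, hinv, h0, euler_invert, map_neg, map_mul, map_mul,
      LaurentPolynomial.invert_C, LaurentPolynomial.invert_T, neg_neg]
    ring

end Swap

/-! ### The leading form is a monomial with an odd exponent. -/

section Main

theorem exists_eq_C_mul_X_pow {k : Type*} [Field k] [IsAlgClosed k] (p : Polynomial k) (hp : p ≠ 0) (hroot : ∀ x, p.eval x = 0 → x = 0) :
    ∃ (κ : k) (b : ℕ), κ ≠ 0 ∧ p = Polynomial.C κ * Polynomial.X ^ b := by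
  obtain ⟨q, hq, hdvd⟩ := Polynomial.exists_eq_pow_rootMultiplicity_mul_and_not_dvd p hp 0
  rw [Polynomial.C_0, sub_zero] at hq hdvd
  have hdeg : q.degree = 0 := by
    by_contra hne
    obtain ⟨x, hx⟩ := IsAlgClosed.exists_root q hne
    have h0 : x = 0 := hroot x (by rw [hq, Polynomial.eval_mul, hx.eq_zero, mul_zero])
    rw [h0, Polynomial.IsRoot.def, ← Polynomial.coeff_zero_eq_eval_zero] at hx
    exact hdvd (Polynomial.X_dvd_iff.mpr hx)
  rw [Polynomial.eq_C_of_degree_eq_zero hdeg] at hq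
  refine ⟨q.coeff 0, _, ?_, by rw [mul_comm]; exact hq⟩
  intro h0
  rw [h0, Polynomial.C_0, mul_zero] at hq
  exact hp hq

variable {k : Type} [Field k] [IsAlgClosed k]

theorem IsParam.exists_normal_of_hasPole {H : ℕ → MvPolynomial (Fin 2) k}
    (hH : ∀ i, (H i).IsHomogeneous i) {d : ℕ} (hd : 0 < d) (hHd : H d ≠ 0) {c : k} {f g : k[T;T⁻¹]}
    (h : IsParam (∑ i ∈ Finset.range (d + 1), H i - MvPolynomial.C c) f g) {n n' : ℕ}
    {v v' : Fin 2 → k} (hv : HasPole f g n v)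
    (hv' : HasPole (LaurentPolynomial.invert f) (LaurentPolynomial.invert g) n' v')
    (hv1 : v 1 = 0) (hv0 : v' 0 = 0) :
    ∃ (f g : k[T;T⁻¹]) (n n' : ℕ) (q₁ q₂ q₁' q₂' : Polynomial k),
      IsParam (∑ i ∈ Finset.range (d + 1), H i - MvPolynomial.C c) f g ∧
      HorizontalPole f g n q₁ q₂ ∧
      HorizontalPole (LaurentPolynomial.invert g) (LaurentPolynomial.invert f) n' q₁' q₂' ∧
      n + n' = d ∧
      ∀ w : Fin 2 → k, w 0 ≠ 0 → w 1 ≠ 0 → MvPolynomial.aeval ![w 0, w 1] (H d) ≠ 0 := by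
  obtain ⟨hnn, hw⟩ := h.add_eq_degree hH hd hHd hv hv'
  have hv00 : v 0 ≠ 0 := fun h0 => hv.ne (funext (Fin.forall_fin_two.mpr ⟨h0, hv1⟩))
  have hv10 : v' 1 ≠ 0 := fun h0 => hv'.ne (funext (Fin.forall_fin_two.mpr ⟨hv0, h0⟩))
  obtain ⟨q₁, q₂, hq⟩ := hv.exists_horizontalPole hv1
  have hswap : HasPole (LaurentPolynomial.invert g) (LaurentPolynomial.invert f) n'
      ![v' 1, v' 0] := ⟨hv'.pos, hv'.right_zero, hv'.left_zero, hv'.right, hv'.left, fun h0 =>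
        hv10 (congrFun h0 0)⟩
  obtain ⟨q₁', q₂', hq'⟩ := hswap.exists_horizontalPole hv0
  refine ⟨f, g, n, n', q₁, q₂, q₁', q₂', h, hq, hq', hnn, fun w h0 h1 => hw w ?_ ?_⟩
  · simp [hv1, h1, hv00]
  · simp [hv0, h0, hv10]

/-- The leading form vanishes only in the pole directions, so the two poles point along the two
axes. Replacing t by 1/t if necessary puts the horizontal one at t = 0. -/
theorem IsParam.exists_normal {H : ℕ → MvPolynomial (Fin 2) k}
    (hH : ∀ i, (H i).IsHomogeneous i) {d : ℕ} (hd : 0 < d) (hHd : H d ≠ 0)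
    (h10 : MvPolynomial.aeval ![(1 : k), 0] (H d) = 0)
    (h01 : MvPolynomial.aeval ![(0 : k), 1] (H d) = 0) {c : k} {f g : k[T;T⁻¹]}
    (h : IsParam (∑ i ∈ Finset.range (d + 1), H i - MvPolynomial.C c) f g) :
    ∃ (f g : k[T;T⁻¹]) (n n' : ℕ) (q₁ q₂ q₁' q₂' : Polynomial k),
      IsParam (∑ i ∈ Finset.range (d + 1), H i - MvPolynomial.C c) f g ∧
      HorizontalPole f g n q₁ q₂ ∧
      HorizontalPole (LaurentPolynomial.invert g) (LaurentPolynomial.invert f) n' q₁' q₂' ∧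
      n + n' = d ∧
      ∀ w : Fin 2 → k, w 0 ≠ 0 → w 1 ≠ 0 → MvPolynomial.aeval ![w 0, w 1] (H d) ≠ 0 := by
  have hv := h.hasPole_poleOrder
  have hv' := h.invert.hasPole_poleOrder
  set v : Fin 2 → k := ![f.coeff _, g.coeff _]
  set v' : Fin 2 → k := ![(LaurentPolynomial.invert f).coeff _, (LaurentPolynomial.invert g).coeff _]
  obtain ⟨-, hw⟩ := h.add_eq_degree hH hd hHd hv hv'
  have a1 : v 1 = 0 ∨ v' 1 = 0 := by
    by_contra! hne
    exact hw ![1, 0] (by simpa using hne.1) (by simpa using hne.2) (by simpa using h10)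
  have a0 : v 0 = 0 ∨ v' 0 = 0 := by
    by_contra! hne
    exact hw ![0, 1] (by simpa using hne.1) (by simpa using hne.2) (by simpa using h01)
  have hne : ¬ (v 0 = 0 ∧ v 1 = 0) := fun h0 => hv.ne (funext (Fin.forall_fin_two.mpr h0))
  have hne' : ¬ (v' 0 = 0 ∧ v' 1 = 0) := fun h0 => hv'.ne (funext (Fin.forall_fin_two.mpr h0))
  by_cases hv1 : v 1 = 0
  · exact h.exists_normal_of_hasPole hH hd hHd hv hv' hv1 (by tauto)
  · refine h.invert.exists_normal_of_hasPole hH hd hHd hv' (v' := v) (n' := poleOrder f g) ?_ (by tauto) (by tauto)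
    rw [LaurentPolynomial.involutive_invert, LaurentPolynomial.involutive_invert]
    exact hv

variable [CharZero k]

/-- If infinitely many curves in a pencil are isomorphic to the punctured line and the leading form
vanishes at `(1 : 0)` and `(0 : 1)`, then the leading form is a monomial, and not a square. -/
theorem leading_form_not_square {H : ℕ → MvPolynomial (Fin 2) k}
    (hH : ∀ i, (H i).IsHomogeneous i) {d : ℕ} (hd : 0 < d) (hHd : H d ≠ 0)
    (h10 : MvPolynomial.aeval ![(1 : k), 0] (H d) = 0)
    (h01 : MvPolynomial.aeval ![(0 : k), 1] (H d) = 0)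
    (hinf : {c : k | ∃ f g,
      IsParam (∑ i ∈ Finset.range (d + 1), H i - MvPolynomial.C c) f g}.Infinite) :
    ∃ (κ : k) (a b : ℕ), κ ≠ 0 ∧
      (∀ x y : k, MvPolynomial.aeval ![x, y] (H d) = κ * x ^ a * y ^ b) ∧
      ¬ (Even a ∧ Even b) := by
  set S := {c : k | ∃ f g, IsParam (∑ i ∈ Finset.range (d + 1), H i - MvPolynomial.C c) f g}
    with hS
  have hdata : ∀ c ∈ S, ∃ (f g : k[T;T⁻¹]) (n n' : ℕ) (q₁ q₂ q₁' q₂' : Polynomial k),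
      IsParam (∑ i ∈ Finset.range (d + 1), H i - MvPolynomial.C c) f g ∧
      HorizontalPole f g n q₁ q₂ ∧
      HorizontalPole (LaurentPolynomial.invert g) (LaurentPolynomial.invert f) n' q₁' q₂' ∧
      n + n' = d ∧
      ∀ w : Fin 2 → k, w 0 ≠ 0 → w 1 ≠ 0 → MvPolynomial.aeval ![w 0, w 1] (H d) ≠ 0 := by
    rintro c ⟨f, g, hc⟩
    exact hc.exists_normal hH hd hHd h10 h01
  choose! f g n n' q₁ q₂ q₁' q₂' hpar hpole hpole' hnn hw using hdata
  have hcurve : ∀ c ∈ S, ∃ e : ℤ, CurveData H d c (f c) (g c) e ∧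
      CurveData (fun i => swapVars (H i)) d c (LaurentPolynomial.invert (g c))
        (LaurentPolynomial.invert (f c)) (-e) := fun c hc => (hpar c hc).curveData
  choose! e he he' using hcurve
  have hne : ∀ x y : k, x ≠ 0 → y ≠ 0 → MvPolynomial.aeval ![x, y] (H d) ≠ 0 := by
    intro x y hx hy
    obtain ⟨c, hc⟩ := hinf.nonempty
    exact hw c hc ![x, y] hx hy
  have hH' : ∀ i, ((fun i => swapVars (H i)) i).IsHomogeneous i := fun i =>
    swapVars_isHomogeneous (hH i)
  have hev : ∀ x, (dehomog (H d)).eval x = MvPolynomial.aeval ![1, x] (H d) := fun x => by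
    rw [← aeval_dehomog]; simp
  have hev' : ∀ x, (dehomog (swapVars (H d))).eval x = MvPolynomial.aeval ![x, 1] (H d) :=
    fun x => by rw [← aeval_swapVars, ← aeval_dehomog]; simp
  have hp0 : dehomog (H d) ≠ 0 := by
    intro h0
    apply hne 1 1 one_ne_zero one_ne_zero
    rw [← hev, h0, Polynomial.eval_zero]
  have hp0' : dehomog (swapVars (H d)) ≠ 0 := by
    intro h0
    apply hne 1 1 one_ne_zero one_ne_zero
    rw [← hev', h0, Polynomial.eval_zero]
  obtain ⟨κ, b, hκ, hb⟩ := exists_eq_C_mul_X_pow _ hp0 (by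
    intro x hx
    by_contra hx0
    exact hne 1 x one_ne_zero hx0 (by rw [← hev, hx]))
  obtain ⟨κ', a, hκ', ha⟩ := exists_eq_C_mul_X_pow _ hp0' (by
    intro x hx
    by_contra hx0
    exact hne x 1 hx0 one_ne_zero (by rw [← hev', hx]))
  have hb0 : 0 < b := by
    rw [Nat.pos_iff_ne_zero]
    rintro rfl
    have := hev 0
    rw [hb, h10] at this
    simp at this
    exact hκ this
  have ha0 : 0 < a := by
    rw [Nat.pos_iff_ne_zero]
    rintro rfl
    have := hev' 0
    rw [ha, h01] at this
    simp at this
    exact hκ' this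
  have hform : ∀ x y : k, x ≠ 0 → MvPolynomial.aeval ![x, y] (H d) = x ^ d * (κ * (y / x) ^ b) := by
    intro x y hx
    have := aeval_pair_eq_dehomog (hH d) x (y / x)
    rw [mul_div_cancel₀ y hx, hb] at this
    simpa using this
  have hone : ∀ y : k, y ≠ 0 → κ * y ^ (a + b) = κ' * y ^ d := by
    intro y hy
    have h1 := hform 1 y one_ne_zero
    have h2 := aeval_pair_eq_dehomog (hH' d) y (1 / y)
    rw [mul_div_cancel₀ 1 hy, aeval_swapVars, h1, ha] at h2
    simp at h2
    rw [pow_add, mul_comm (y ^ a), ← mul_assoc, h2]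
    field_simp
  have hκκ : κ = κ' := by simpa using hone 1 one_ne_zero
  -- The two dehomogenisations are compared at y = 2, whose powers are distinct in characteristic 0.
  have hab : a + b = d := by
    have h2 := hone 2 two_ne_zero
    rw [← hκκ] at h2
    have h3 : ((2 ^ (a + b) : ℕ) : k) = ((2 ^ d : ℕ) : k) := by
      push_cast
      exact mul_left_cancel₀ hκ h2
    exact Nat.pow_right_injective le_rfl (Nat.cast_injective h3)
  -- The bounds n ≤ b and n' ≤ a are equalities because both sums are d.
  have hnb : ∀ c ∈ S, n c = b ∧ n' c = a := by
    intro c hc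
    have h1 := (hpole c hc).le_of_dehomog_eq hH hd (he c hc) hκ hb
    have h2 := (hpole' c hc).le_of_dehomog_eq hH' hd (he' c hc) hκ' ha
    have h3 := hnn c hc
    omega
  refine ⟨κ, a, b, hκ, ?_, ?_⟩
  · intro x y
    by_cases hx : x = 0
    · have h1 := aeval_mul_of_isHomogeneous (hH d) y 0 1
      rw [h01] at h1
      simp only [mul_zero, mul_one] at h1
      rw [hx, h1, zero_pow ha0.ne', mul_zero, zero_mul]
    · rw [hform x y hx, ← hab, div_pow, pow_add]
      field_simp
  · rintro ⟨hae, hbe⟩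
    have hde : Even d := hab ▸ hae.add hbe
    -- The bound at the first point fails for finitely many c only. Removing these, the bound at the
    -- second point holds for some c that also satisfies the first.
    have hfin : {c ∈ S | ¬ e c < 2 * b - d}.Finite := by
      by_contra hinf'
      obtain ⟨c, hc, hlt⟩ := exists_exponent_lt hH hb0 hbe hd hde hκ hb _ hinf' f g e
        (fun c hc => he c hc.1)
        (fun c hc => ⟨q₁ c, q₂ c, (hnb c hc.1).1 ▸ hpole c hc.1⟩)
      exact hc.2 hlt
    have hinf2 := hinf.sdiff hfin
    obtain ⟨c, hc, hlt⟩ := exists_exponent_lt hH' ha0 hae hd hde hκ' ha _ hinf2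
      (fun c => LaurentPolynomial.invert (g c)) (fun c => LaurentPolynomial.invert (f c))
      (fun c => -e c) (fun c hc => he' c hc.1)
      (fun c hc => ⟨q₁' c, q₂' c, (hnb c hc.1).2 ▸ hpole' c hc.1⟩)
    have hlt2 : e c < 2 * b - d := by
      by_contra hcon
      exact hc.2 ⟨hc.1, hcon⟩
    have : (d : ℤ) = a + b := by exact_mod_cast hab.symm
    omega

end Main

/-! ### Extension of scalars. -/

section BaseChange

variable {k K : Type*} [Field k] [Field K]

/-- The variable of the Laurent polynomial ring, as a unit. -/
def unitT : (K[T;T⁻¹])ˣ where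
  val := LaurentPolynomial.T 1
  inv := LaurentPolynomial.T (-1)
  val_inv := by rw [← LaurentPolynomial.T_add]; simp
  inv_val := by rw [← LaurentPolynomial.T_add]; simp

/-- Extension of scalars for Laurent polynomials. -/
def laurentMap (ι : k →+* K) : k[T;T⁻¹] →+* K[T;T⁻¹] :=
  LaurentPolynomial.eval₂ (LaurentPolynomial.C.comp ι) unitT

theorem laurentMap_C (ι : k →+* K) (a : k) :
    laurentMap ι (LaurentPolynomial.C a) = LaurentPolynomial.C (ι a) :=
  LaurentPolynomial.eval₂_C _ _ _

theorem laurentMap_T_one (ι : k →+* K) :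
    laurentMap ι (LaurentPolynomial.T 1) = LaurentPolynomial.T 1 := by
  rw [laurentMap, LaurentPolynomial.eval₂_T, zpow_one]
  rfl

theorem laurentMap_T_neg_one (ι : k →+* K) :
    laurentMap ι (LaurentPolynomial.T (-1)) = LaurentPolynomial.T (-1) := by
  rw [laurentMap, LaurentPolynomial.eval₂_T, zpow_neg_one]
  rfl

theorem aeval_laurentMap (ι : k →+* K) (f g : k[T;T⁻¹]) (P : MvPolynomial (Fin 2) k) :
    MvPolynomial.aeval ![laurentMap ι f, laurentMap ι g] (MvPolynomial.map ι P) =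
      laurentMap ι (MvPolynomial.aeval ![f, g] P) := by
  induction P using MvPolynomial.induction_on with
  | C a =>
    rw [MvPolynomial.map_C, MvPolynomial.aeval_C, MvPolynomial.aeval_C]
    exact (laurentMap_C ι a).symm
  | add P Q hP hQ => rw [map_add, map_add, hP, hQ, map_add, map_add]
  | mul_X P i hP =>
    rw [map_mul, map_mul, hP, map_mul, map_mul, MvPolynomial.map_X, MvPolynomial.aeval_X,
      MvPolynomial.aeval_X]
    fin_cases i <;> rfl

/-- A property of Laurent polynomials that is closed under ring operations holds for all of them as
soon as it holds for the constants, `T` and `T⁻¹`. -/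
theorem laurent_induction {M : k[T;T⁻¹] → Prop} (p : k[T;T⁻¹])
    (hC : ∀ a, M (LaurentPolynomial.C a)) (hadd : ∀ p q, M p → M q → M (p + q))
    (hmul : ∀ p q, M p → M q → M (p * q)) (hT : M (LaurentPolynomial.T 1))
    (hT' : M (LaurentPolynomial.T (-1))) : M p := by
  refine LaurentPolynomial.induction_on p hC (fun h1 h2 => hadd _ _ h1 h2) ?_ ?_
  · intro n a h
    rw [LaurentPolynomial.T_add, ← mul_assoc]
    exact hmul _ _ h hT
  · intro n a h
    rw [sub_eq_add_neg, LaurentPolynomial.T_add, ← mul_assoc]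
    exact hmul _ _ h hT'

/-- Parametrizations are preserved by extension of scalars. -/
theorem IsParam.map {F : MvPolynomial (Fin 2) k} {f g : k[T;T⁻¹]} (h : IsParam F f g)
    (ι : k →+* K) : IsParam (MvPolynomial.map ι F) (laurentMap ι f) (laurentMap ι g) := by
  obtain ⟨P, hP⟩ := h.surj (LaurentPolynomial.T 1)
  obtain ⟨P', hP'⟩ := h.surj (LaurentPolynomial.T (-1))
  constructor
  · intro b
    refine laurent_induction (M := fun b => ∃ Q, MvPolynomial.aeval (R := K)
      ![laurentMap ι f, laurentMap ι g] Q = b) b ?_ ?_ ?_ ?_ ?_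
    · exact fun a => ⟨MvPolynomial.C a, by rw [MvPolynomial.aeval_C]; rfl⟩
    · rintro _ _ ⟨Q, rfl⟩ ⟨R, rfl⟩
      exact ⟨Q + R, map_add _ _ _⟩
    · rintro _ _ ⟨Q, rfl⟩ ⟨R, rfl⟩
      exact ⟨Q * R, map_mul _ _ _⟩
    · exact ⟨MvPolynomial.map ι P, by rw [aeval_laurentMap, hP, laurentMap_T_one]⟩
    · exact ⟨MvPolynomial.map ι P', by rw [aeval_laurentMap, hP', laurentMap_T_neg_one]⟩
  · set I := Ideal.span {MvPolynomial.map ι F}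
    have hmk : ∀ Q R : MvPolynomial (Fin 2) k,
        MvPolynomial.aeval ![f, g] Q = MvPolynomial.aeval ![f, g] R →
        Ideal.Quotient.mk I (MvPolynomial.map ι Q) = Ideal.Quotient.mk I (MvPolynomial.map ι R) := by
      intro Q R hQR
      rw [Ideal.Quotient.eq, ← map_sub, Ideal.mem_span_singleton]
      refine map_dvd _ ((h.ker _).mp ?_)
      rw [map_sub, hQR, sub_self]
    have hone : Ideal.Quotient.mk I (MvPolynomial.map ι P) *
        Ideal.Quotient.mk I (MvPolynomial.map ι P') = 1 := by
      rw [← map_mul, ← map_mul, hmk (P * P') 1, map_one, map_one]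
      rw [map_mul, hP, hP', ← LaurentPolynomial.T_add, map_one]
      simp
    let u : (MvPolynomial (Fin 2) K ⧸ I)ˣ := ⟨_, _, hone, by rw [mul_comm, hone]⟩
    -- A left inverse of the parametrisation on the coordinate ring, sending T to the class of its
    -- lift; it shows that the kernel is no larger than (F).
    let ρ : K[T;T⁻¹] →+* MvPolynomial (Fin 2) K ⧸ I :=
      LaurentPolynomial.eval₂ ((Ideal.Quotient.mk I).comp MvPolynomial.C) u
    have hρC : ∀ a, ρ (LaurentPolynomial.C a) = Ideal.Quotient.mk I (MvPolynomial.C a) :=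
      fun a => LaurentPolynomial.eval₂_C _ _ _
    have hρT : ρ (LaurentPolynomial.T 1) = Ideal.Quotient.mk I (MvPolynomial.map ι P) := by
      simp only [ρ, LaurentPolynomial.eval₂_T, zpow_one, u]
    have hρT' : ρ (LaurentPolynomial.T (-1)) = Ideal.Quotient.mk I (MvPolynomial.map ι P') := by
      simp only [ρ, LaurentPolynomial.eval₂_T, zpow_neg_one, u, Units.inv_mk]
    have hρ : ∀ b : k[T;T⁻¹], ∃ Q, MvPolynomial.aeval ![f, g] Q = b ∧
        ρ (laurentMap ι b) = Ideal.Quotient.mk I (MvPolynomial.map ι Q) := by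
      intro b
      refine laurent_induction (M := fun b : k[T;T⁻¹] => ∃ Q, MvPolynomial.aeval ![f, g] Q = b ∧
        ρ (laurentMap ι b) = Ideal.Quotient.mk I (MvPolynomial.map ι Q)) b ?_ ?_ ?_ ?_ ?_
      · intro a
        refine ⟨MvPolynomial.C a, by rw [MvPolynomial.aeval_C]; rfl, ?_⟩
        rw [laurentMap_C, hρC, MvPolynomial.map_C]
      · rintro p q ⟨Q, rfl, hQ⟩ ⟨R, rfl, hR⟩
        exact ⟨Q + R, map_add _ _ _, by rw [map_add, map_add, hQ, hR, map_add, map_add]⟩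
      · rintro p q ⟨Q, rfl, hQ⟩ ⟨R, rfl, hR⟩
        exact ⟨Q * R, map_mul _ _ _, by rw [map_mul, map_mul, hQ, hR, map_mul, map_mul]⟩
      · exact ⟨P, hP, by rw [laurentMap_T_one, hρT]⟩
      · exact ⟨P', hP', by rw [laurentMap_T_neg_one, hρT']⟩
    have hρ' : ∀ Q : MvPolynomial (Fin 2) k, ρ (laurentMap ι (MvPolynomial.aeval ![f, g] Q)) =
        Ideal.Quotient.mk I (MvPolynomial.map ι Q) := by
      intro Q
      obtain ⟨R, hR, hR'⟩ := hρ (MvPolynomial.aeval ![f, g] Q)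
      rw [hR', hmk _ _ hR]
    have hall : ∀ Q : MvPolynomial (Fin 2) K,
        ρ (MvPolynomial.aeval ![laurentMap ι f, laurentMap ι g] Q) = Ideal.Quotient.mk I Q := by
      intro Q
      induction Q using MvPolynomial.induction_on with
      | C a => rw [MvPolynomial.aeval_C]; exact hρC a
      | add P Q hP hQ => rw [map_add, map_add, hP, hQ, map_add]
      | mul_X P i hP =>
        rw [map_mul, map_mul, hP, map_mul, MvPolynomial.aeval_X]
        congr 1
        have := hρ' (MvPolynomial.X i)
        rw [MvPolynomial.map_X, MvPolynomial.aeval_X] at this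
        rw [← this]
        fin_cases i <;> rfl
    intro Q
    constructor
    · intro hQ
      have := hall Q
      rw [hQ, map_zero] at this
      exact Ideal.mem_span_singleton.mp (Ideal.Quotient.eq_zero_iff_mem.mp this.symm)
    · rintro ⟨R, rfl⟩
      rw [map_mul, aeval_laurentMap, (h.ker F).mpr dvd_rfl, map_zero, zero_mul]

end BaseChange

/-! ### From isomorphisms of coordinate rings to pairs of Laurent polynomials. -/

section OfParametrisation

variable {k : Type} [Field k]

theorem Parametrisation.isParam {G : MvPolynomial (Fin 2) k} (φ : Parametrisation G) :
    IsParam G (Parametrisation.component φ 0) (Parametrisation.component φ 1) := by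
  have h : ∀ P, MvPolynomial.aeval
      ![Parametrisation.component φ 0, Parametrisation.component φ 1] P =
      φ (Ideal.Quotient.mk _ P) := fun P =>
    (aeval_pair_ext ((φ : CoordRing G →ₐ[k] k[T;T⁻¹]).comp (Ideal.Quotient.mkₐ k _)) P).symm
  constructor
  · intro b
    obtain ⟨a, rfl⟩ := φ.surjective b
    obtain ⟨P, rfl⟩ := Ideal.Quotient.mk_surjective a
    exact ⟨P, h P⟩
  · intro P
    rw [h, map_eq_zero_iff _ φ.injective, Ideal.Quotient.eq_zero_iff_mem,
      Ideal.mem_span_singleton]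

/-- Points at infinity with distinct images have independent leading coefficients. -/
theorem Parametrisation.det_ne_zero {G : MvPolynomial (Fin 2) k} (φ : Parametrisation G)
    (hφ : Parametrisation.imageZero φ ≠ Parametrisation.imageInfty φ) :
    ∃ (n n' : ℕ) (v v' : Fin 2 → k),
      HasPole (Parametrisation.component φ 0) (Parametrisation.component φ 1) n v ∧
      HasPole (LaurentPolynomial.invert (Parametrisation.component φ 0))
        (LaurentPolynomial.invert (Parametrisation.component φ 1)) n' v' ∧
      v 0 * v' 1 - v 1 * v' 0 ≠ 0 := by
  set f := Parametrisation.component φ 0 with hf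
  set g := Parametrisation.component φ 1 with hg
  have hv := (Parametrisation.isParam φ).hasPole_poleOrder
  have hv' := (Parametrisation.isParam φ).invert.hasPole_poleOrder
  refine ⟨_, _, _, _, hv, hv', fun hdet => hφ ?_⟩
  rw [← hf, ← hg] at hv hv' hdet
  simp only [Matrix.cons_val_zero, Matrix.cons_val_one, Matrix.cons_val_fin_one] at hdet
  rw [Parametrisation.imageZero, Parametrisation.imageInfty, ← hf, ← hg, valueAtZero, valueAtZero,
    Projectivization.mk_eq_mk_iff']
  have e := hv.ne
  have e' := hv'.ne
  have p := hv.pos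
  have p' := hv'.pos
  unfold leadingVector
  rw [if_neg p.ne', if_neg p'.ne']
  generalize f.coeff (-(poleOrder f g : ℤ)) = a at *
  generalize g.coeff (-(poleOrder f g : ℤ)) = b at *
  generalize (LaurentPolynomial.invert f).coeff _ = a' at *
  generalize (LaurentPolynomial.invert g).coeff _ = b' at *
  by_cases ha : a' = 0
  · have hb : b' ≠ 0 := by
      rintro rfl
      exact e' (by rw [ha]; simp)
    have ha0 : a = 0 := by
      rw [ha, mul_zero, sub_zero] at hdet
      exact (mul_eq_zero.mp hdet).resolve_right hb
    refine ⟨b / b', ?_⟩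
    funext i
    fin_cases i <;> simp [ha, ha0, hb]
  · refine ⟨a / a', ?_⟩
    have : a / a' * b' = b := by
      field_simp
      linear_combination hdet
    funext i
    fin_cases i <;> simp [ha, this]

end OfParametrisation

/-! ### From a negative value of the leading form to weak approximation. -/

section Rational

theorem exists_nat_aeval_neg {H : ℕ → MvPolynomial (Fin 2) ℚ} (hH : ∀ i, (H i).IsHomogeneous i)
    (d : ℕ) (x₀ y₀ p q : ℚ) (h : MvPolynomial.aeval ![p, q] (H d) < 0) :
    ∃ s : ℕ, MvPolynomial.aeval ![x₀ + p * s, y₀ + q * s]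
      (∑ i ∈ Finset.range (d + 1), H i) < 0 := by
  -- This is εᵈ F(x₀ + p/ε, y₀ + q/ε) for ε ≠ 0, extended continuously to ε = 0 by H_d(p, q).
  let G : ℚ → ℚ := fun ε => ∑ i ∈ Finset.range (d + 1),
    ε ^ (d - i) * MvPolynomial.aeval ![x₀ * ε + p, y₀ * ε + q] (H i)
  have hcont : Continuous G := by
    refine continuous_finsetSum _ fun i _ => (continuous_pow _).mul ?_
    refine (MvPolynomial.continuous_eval (H i)).comp (continuous_pi (Fin.forall_fin_two.mpr ?_))
    constructor
    · exact (continuous_const.mul continuous_id).add continuous_const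
    · exact (continuous_const.mul continuous_id).add continuous_const
  have h0 : G 0 < 0 := by
    simp only [G]
    rw [Finset.sum_range_succ, Finset.sum_eq_zero]
    · simpa using h
    · intro i hi
      rw [Finset.mem_range] at hi
      rw [zero_pow (by omega), zero_mul]
  have h1 := (hcont.tendsto 0).eventually_lt_const h0
  have h2 : Filter.Tendsto (fun n : ℕ => ((n : ℚ))⁻¹) Filter.atTop (nhds 0) :=
    tendsto_inv_atTop_zero.comp tendsto_natCast_atTop_atTop
  obtain ⟨s, hs, hs0⟩ := ((h2.eventually h1).and (Filter.eventually_gt_atTop 0)).exists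
  refine ⟨s, ?_⟩
  have hsq : (0 : ℚ) < s := by exact_mod_cast hs0
  have key : MvPolynomial.aeval ![x₀ + p * s, y₀ + q * s] (∑ i ∈ Finset.range (d + 1), H i) =
      (s : ℚ) ^ d * G (s : ℚ)⁻¹ := by
    simp only [G]
    rw [map_sum, Finset.mul_sum]
    refine Finset.sum_congr rfl fun i hi => ?_
    have hle : i ≤ d := Nat.lt_succ_iff.mp (Finset.mem_range.mp hi)
    have h3 := aeval_mul_of_isHomogeneous (hH i) (s : ℚ) (x₀ * (s : ℚ)⁻¹ + p)
      (y₀ * (s : ℚ)⁻¹ + q)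
    have e1 : (s : ℚ) * (x₀ * (s : ℚ)⁻¹ + p) = x₀ + p * s := by field_simp
    have e2 : (s : ℚ) * (y₀ * (s : ℚ)⁻¹ + q) = y₀ + q * s := by field_simp
    rw [e1, e2] at h3
    rw [h3, ← mul_assoc]
    congr 1
    obtain ⟨j, rfl⟩ := Nat.exists_eq_add_of_le hle
    rw [Nat.add_sub_cancel_left, pow_add, mul_assoc, ← mul_pow, mul_inv_cancel₀ hsq.ne',
      one_pow, mul_one]
  rw [key]
  exact mul_neg_of_pos_of_neg (pow_pos hsq d) hs

theorem weakApproximation_of_neg {H : ℕ → MvPolynomial (Fin 2) ℚ}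
    (hH : ∀ i, (H i).IsHomogeneous i) (d : ℕ) (p q : ℚ)
    (h : MvPolynomial.aeval ![p, q] (H d) < 0) :
    WeakApproximation {x : ℚ × ℚ | MvPolynomial.eval ![x.1, x.2]
      (∑ i ∈ Finset.range (d + 1), H i) < 0} := by
  intro x₀ y₀ N hN
  have hD : (0 : ℚ) < N * (p.den * q.den) := by
    have := p.den_pos
    have := q.den_pos
    positivity
  -- The factor N · den p · den q makes both increments integer multiples of N; being positive, it
  -- preserves the sign of H_d by homogeneity.
  obtain ⟨s, hs⟩ := exists_nat_aeval_neg hH d x₀ y₀ (N * (p.den * q.den) * p)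
    (N * (p.den * q.den) * q) (by
      rw [aeval_mul_of_isHomogeneous (hH d)]
      exact mul_neg_of_pos_of_neg (pow_pos hD d) h)
  refine ⟨(_, _), hs, ⟨p.num * q.den * s, ?_⟩, ⟨q.num * p.den * s, ?_⟩⟩
  · push_cast
    rw [← Rat.mul_den_eq_num p]
    ring
  · push_cast
    rw [← Rat.mul_den_eq_num q]
    ring

theorem aeval_nonneg_of_rat {P : MvPolynomial (Fin 2) ℚ}
    (h : ∀ p q : ℚ, 0 ≤ MvPolynomial.aeval ![p, q] P) (x y : ℝ) :
    0 ≤ MvPolynomial.aeval ![x, y] P := by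
  refine DenseRange.induction_on₂ (p := fun x y : ℝ => 0 ≤ MvPolynomial.aeval ![x, y] P)
    Rat.denseRange_cast ?_ ?_ x y
  · refine isClosed_le continuous_const ?_
    have h1 : Continuous fun z : ℝ × ℝ => (![z.1, z.2] : Fin 2 → ℝ) :=
      continuous_pi (Fin.forall_fin_two.mpr ⟨continuous_fst, continuous_snd⟩)
    have h2 := (MvPolynomial.continuous_eval (MvPolynomial.map (algebraMap ℚ ℝ) P)).comp h1
    refine h2.congr fun z => ?_
    rw [Function.comp_apply, MvPolynomial.eval_map, MvPolynomial.aeval_def]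
  · intro p q
    have h1 := map_aeval_pair (Algebra.ofId ℚ ℝ) p q P
    rw [Algebra.ofId_apply, Algebra.ofId_apply, Algebra.ofId_apply] at h1
    simp only [eq_ratCast] at h1
    rw [← h1]
    exact_mod_cast h p q

end Rational

/-! ### Conclusion over ℚ, ℝ and ℂ. -/

section Final

theorem infinite_isParam_complex {F : MvPolynomial (Fin 2) ℚ}
    (hgen : {c : AlgebraicClosure ℚ | ¬ IsPuncturedLine
      (MvPolynomial.map (algebraMap ℚ (AlgebraicClosure ℚ)) F - MvPolynomial.C c)}.Finite) :
    {c : ℂ | ∃ f g, IsParam (MvPolynomial.map (algebraMap ℚ ℂ) F - MvPolynomial.C c)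
      f g}.Infinite := by
  have halg : Algebra.IsAlgebraic ℚ (AlgebraicClosure ℚ) := by
    convert AlgebraicClosure.isAlgebraic ℚ
    · rfl
    · exact Subsingleton.elim _ _
  let ι : AlgebraicClosure ℚ →+* ℂ :=
    ((IsAlgClosed.lift : AlgebraicClosure ℚ →ₐ[ℚ] ℂ) : AlgebraicClosure ℚ →+* ℂ)
  have h1 := hgen.infinite_compl.image (f := ι) ι.injective.injOn
  refine h1.mono ?_
  rintro _ ⟨c, hc, rfl⟩
  obtain ⟨ψ⟩ := not_not.mp hc
  have h2 := (Parametrisation.isParam ψ).map ι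
  rw [map_sub, MvPolynomial.map_map, MvPolynomial.map_C,
    Subsingleton.elim (ι.comp (algebraMap ℚ (AlgebraicClosure ℚ))) (algebraMap ℚ ℂ)] at h2
  exact ⟨_, _, h2⟩

theorem homogeneousComponent_totalDegree_ne_zero {σ k : Type*} [Field k] {F : MvPolynomial σ k}
    (h : F ≠ 0) : MvPolynomial.homogeneousComponent F.totalDegree F ≠ 0 := by
  obtain ⟨s, hs, hd⟩ := Finset.exists_mem_eq_sup F.support
    (MvPolynomial.support_nonempty.mpr h) (fun s => s.sum fun _ e => e)
  intro h0
  have h1 := congrArg (MvPolynomial.coeff s) h0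
  rw [MvPolynomial.coeff_homogeneousComponent, if_pos, MvPolynomial.coeff_zero] at h1
  · exact MvPolynomial.mem_support_iff.mp hs h1
  · rw [MvPolynomial.totalDegree, hd]
    rfl

/-- For constant F, all but one F - c are units, so the coordinate ring would be zero. -/
theorem totalDegree_pos_of_infinite_isParam {F : MvPolynomial (Fin 2) ℚ}
    (hinf : {c : ℂ | ∃ f g, IsParam (MvPolynomial.map (algebraMap ℚ ℂ) F - MvPolynomial.C c)
      f g}.Infinite) : 0 < F.totalDegree := by
  rw [Nat.pos_iff_ne_zero]
  intro h0
  rw [MvPolynomial.totalDegree_eq_zero_iff_eq_C] at h0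
  obtain ⟨c, ⟨f, g, hc⟩, hne⟩ := hinf.exists_notMem_finset {algebraMap ℚ ℂ (F.coeff 0)}
  rw [h0, MvPolynomial.map_C, ← MvPolynomial.C_sub] at hc
  have hu : IsUnit (algebraMap ℚ ℂ (F.coeff 0) - c) := by
    rw [isUnit_iff_ne_zero, sub_ne_zero]
    exact fun h => hne (by simp [h])
  have h1 := (hc.ker 1).mpr (hu.map MvPolynomial.C).dvd
  rw [map_one] at h1
  exact one_ne_zero h1

/-- If the two points at infinity of one member of the pencil are real and distinct, then the leading
form is negative at some rational point. -/
theorem exists_rat_leading_neg {H : ℕ → MvPolynomial (Fin 2) ℚ}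
    (hH : ∀ i, (H i).IsHomogeneous i) {d : ℕ} (hd : 0 < d) (hHd : H d ≠ 0)
    (hinf : {c : ℂ | ∃ f g, IsParam (MvPolynomial.map (algebraMap ℚ ℂ)
      (∑ i ∈ Finset.range (d + 1), H i) - MvPolynomial.C c) f g}.Infinite)
    (v v' : Fin 2 → ℝ) (hdet : v 0 * v' 1 - v 1 * v' 0 ≠ 0)
    (hv : MvPolynomial.aeval ![v 0, v 1] (H d) = 0)
    (hv' : MvPolynomial.aeval ![v' 0, v' 1] (H d) = 0) :
    ∃ p q : ℚ, MvPolynomial.aeval ![p, q] (H d) < 0 := by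
  by_contra! hcon
  have hnn := aeval_nonneg_of_rat hcon
  -- The two directions at infinity become the coordinate axes. The change of basis is real, so real
  -- arguments still give nonnegative real values.
  let p : Fin 2 → ℂ := fun i => v i
  let w : Fin 2 → ℂ := fun i => v' i
  have hD : p 0 * w 1 - p 1 * w 0 ≠ 0 := by
    simp only [p, w]
    exact_mod_cast hdet
  let H' : ℕ → MvPolynomial (Fin 2) ℂ := fun i =>
    linSubst p w (MvPolynomial.map (algebraMap ℚ ℂ) (H i))
  have hH' : ∀ i, (H' i).IsHomogeneous i := fun i =>
    linSubst_isHomogeneous ((hH i).map _) p w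
  have hev : ∀ x y : ℝ, MvPolynomial.aeval ![(x : ℂ), (y : ℂ)] (H' d) =
      ((MvPolynomial.aeval ![x * v 0 + y * v' 0, x * v 1 + y * v' 1] (H d) : ℝ) : ℂ) := by
    intro x y
    have h1 := map_aeval_pair (Complex.ofRealAm.restrictScalars ℚ) (x * v 0 + y * v' 0)
      (x * v 1 + y * v' 1) (H d)
    simp only [AlgHom.restrictScalars_apply, Complex.ofRealAm_coe] at h1
    rw [h1, aeval_linSubst, MvPolynomial.aeval_map_algebraMap]
    congr 3
    · simp [p, w, mul_comm]
    · simp [p, w, mul_comm]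
  have h10 : MvPolynomial.aeval ![(1 : ℂ), 0] (H' d) = 0 := by
    have := hev 1 0
    simp only [one_mul, zero_mul, add_zero, hv] at this
    simpa using this
  have h01 : MvPolynomial.aeval ![(0 : ℂ), 1] (H' d) = 0 := by
    have := hev 0 1
    simp only [one_mul, zero_mul, zero_add, hv'] at this
    simpa using this
  have hHd' : H' d ≠ 0 := by
    intro h0
    have h1 := (linSubst_bijective p w hD).1 (h0.trans (map_zero _).symm)
    exact hHd (MvPolynomial.map_injective _ (algebraMap ℚ ℂ).injective (h1.trans (map_zero _).symm))
  obtain ⟨κ, a, b, hκ, hform, hab⟩ := leading_form_not_square hH' hd hHd' h10 h01 (by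
    refine hinf.mono ?_
    rintro c ⟨f, g, hc⟩
    have h1 := hc.linSubst p w hD
    rw [map_sub, map_sum, map_sum, linSubst, MvPolynomial.aeval_C] at h1
    exact ⟨_, _, h1⟩)
  set r : ℝ → ℝ → ℝ := fun x y =>
    MvPolynomial.aeval ![x * v 0 + y * v' 0, x * v 1 + y * v' 1] (H d)
  have hr : ∀ x y, 0 ≤ r x y := fun x y => hnn _ _
  have hrκ : ∀ x y : ℝ, ((r x y : ℝ) : ℂ) = κ * (x : ℂ) ^ a * (y : ℂ) ^ b := fun x y => by
    rw [← hform, hev]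
  have h11 : ((r 1 1 : ℝ) : ℂ) = κ := by simpa using hrκ 1 1
  -- As κ = r(1, 1) is nonnegative and nonzero, -κ is not a value; an odd exponent would produce it
  -- at (-1, 1) or at (1, -1).
  have hzero : ∀ x y : ℝ, ((r x y : ℝ) : ℂ) = -κ → False := by
    intro x y hxy
    rw [← h11] at hxy
    have h2 : r x y = -r 1 1 := by exact_mod_cast hxy
    have h3 := hr x y
    have h4 := hr 1 1
    have h5 : r 1 1 = 0 := by linarith
    rw [h5, Complex.ofReal_zero] at h11
    exact hκ h11.symm
  apply hab
  constructor
  · by_contra ha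
    refine hzero (-1) 1 ?_
    rw [hrκ]
    push_cast
    rw [(Nat.not_even_iff_odd.mp ha).neg_one_pow]
    simp
  · by_contra hb
    refine hzero 1 (-1) ?_
    rw [hrκ]
    push_cast
    rw [(Nat.not_even_iff_odd.mp hb).neg_one_pow]
    simp

theorem weakApproximation_of_imageZero_ne (F : MvPolynomial (Fin 2) ℚ)
    (hgen : {c : AlgebraicClosure ℚ | ¬ IsPuncturedLine
      (MvPolynomial.map (algebraMap ℚ (AlgebraicClosure ℚ)) F - MvPolynomial.C c)}.Finite)
    (φ : Parametrisation (MvPolynomial.map (algebraMap ℚ ℝ) F))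
    (hφ : Parametrisation.imageZero φ ≠ Parametrisation.imageInfty φ) :
    WeakApproximation {p : ℚ × ℚ | MvPolynomial.eval ![p.1, p.2] F < 0} := by
  have hinf := infinite_isParam_complex hgen
  have hd := totalDegree_pos_of_infinite_isParam hinf
  have hsum := MvPolynomial.sum_homogeneousComponent F
  set H : ℕ → MvPolynomial (Fin 2) ℚ := fun i => MvPolynomial.homogeneousComponent i F
  have hH : ∀ i, (H i).IsHomogeneous i := fun i =>
    MvPolynomial.homogeneousComponent_isHomogeneous i F
  have hHd : H F.totalDegree ≠ 0 := homogeneousComponent_totalDegree_ne_zero (by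
    intro h0
    rw [h0, MvPolynomial.totalDegree_zero] at hd
    exact lt_irrefl _ hd)
  generalize F.totalDegree = d at *
  change ∑ i ∈ Finset.range (d + 1), H i = F at hsum
  obtain ⟨n, n', v, v', hv, hv', hdet⟩ := Parametrisation.det_ne_zero φ hφ
  have hHR : ∀ i, (MvPolynomial.map (algebraMap ℚ ℝ) (H i)).IsHomogeneous i := fun i =>
    (hH i).map _
  have hvanish : ∀ {f g : ℝ[T;T⁻¹]} {n : ℕ} {v : Fin 2 → ℝ},
      IsParam (MvPolynomial.map (algebraMap ℚ ℝ) F) f g → HasPole f g n v →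
      MvPolynomial.aeval ![v 0, v 1] (H d) = 0 := by
    intro f g n v h hv
    have h1 := (h.ker _).mpr dvd_rfl
    rw [← hsum, map_sum] at h1
    have h2 := hv.aeval_leading_eq_zero hHR hd (c := 0) (by rw [h1, map_zero])
    rwa [MvPolynomial.aeval_map_algebraMap] at h2
  have hpar := Parametrisation.isParam φ
  obtain ⟨p, q, hpq⟩ := exists_rat_leading_neg hH hd hHd (by rwa [hsum]) v v' hdet
    (hvanish hpar hv) (hvanish hpar.invert hv')
  have := weakApproximation_of_neg hH d p q hpq
  rwa [hsum] at this

end Final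

end PlaneCurve

end

theorem mainTheorem5 (F : MvPolynomial (Fin 2) ℚ)
    (hgen : {c : AlgebraicClosure ℚ | ¬ PlaneCurve.IsPuncturedLine
      (MvPolynomial.map (algebraMap ℚ (AlgebraicClosure ℚ)) F - MvPolynomial.C c)}.Finite)
    (φ : PlaneCurve.Parametrisation (MvPolynomial.map (algebraMap ℚ ℝ) F))
    (hφ : PlaneCurve.Parametrisation.imageZero φ ≠ PlaneCurve.Parametrisation.imageInfty φ) :
    PlaneCurve.WeakApproximation {p : ℚ × ℚ | MvPolynomial.eval ![p.1, p.2] F < 0} :=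
  PlaneCurve.weakApproximation_of_imageZero_ne F hgen φ hφ
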